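/- Let $X$ be a (real or complex) Banach space, let $(T(t))_{t\ge 0}$ be a $C_0$-semigroup on $X$ with generator $A:\operatorname{dom}(A)\subseteq X\to X$, and let $V$ be a Banach space that embeds continuously into $X$. Let $B:\operatorname{dom}(B)\subseteq X\to X$ be a linear operator with $\operatorname{dom}(A)\subseteq\operatorname{dom}(B)$ whose restriction to $\operatorname{dom}(A)$, equipped with the graph norm of $A$, is bounded into $X$. Suppose that there are constants $C\ge 1$, $\alpha>0$, $\beta\in[0,1)$, $q\in(0,1)$ and $t_0>0$ such that: (S1) $T(t)X\subseteq V$ and $\|T(t)\|_{X\to V}\le C t^{-\alpha}$ for all $t\in(0,1]$; (S2) $\int_0^{t_0}\|BT(s)x\|_X\,ds\le q\|x\|_X$ for all $x\in\operatorname{dom}(A)$; (S3) $\|T(t)\|_{V\to V}\le C$ for all $t\in(0,1]$; moreover, $BT(t)x\in V$ and $\|BT(t)x\|_V\le C t^{-\beta}\|x\|_V$ whenever $x\in V$ and $t\in(0,1]$ are such that $T(t)x\in\operatorname{dom}(B)$. Suppose further that $V$ is separable or that the closed unit ball of $V$ is closed in $X$. Finally, suppose that $(T(t))_{t\ge 0}$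 is immediately differentiable, i.e. for every $x\in X$ the orbit $t\mapsto T(t)x$ is differentiable on $(0,\infty)$. Then $A+B$, with domain $\operatorname{dom}(A)$, generates a $C_0$-semigroup $(S(t))_{t\ge 0}$ on $X$, and there exists a constant $\widetilde C>0$ such that $$S(t)X\subseteq V\quad\text{and}\quad \|S(t)\|_{X\to V}\le\widetilde C t^{-\alpha}\qquad\text{for all } t\in(0,1].$$ -/

import Mathlib

open Set Filter Topology

noncomputable section

namespace UltraPerturb

variable {𝕜 X V Y : Type*} [RCLike 𝕜]
  [NormedAddCommGroup X] [NormedSpace 𝕜 X]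
  [NormedAddCommGroup V] [NormedSpace 𝕜 V]
  [NormedAddCommGroup Y] [NormedSpace 𝕜 Y]

/-- `T` is a strongly continuous semigroup `(T(t))_{t ≥ 0}` of bounded linear operators on `X`.
Only the values of `T` on `[0, ∞)` matter. -/
structure IsC0Semigroup (T : ℝ → X →L[𝕜] X) : Prop where
  map_zero : T 0 = ContinuousLinearMap.id 𝕜 X
  map_add : ∀ s t : ℝ, 0 ≤ s → 0 ≤ t → T (s + t) = T s ∘L T t
  continuousOn_orbit : ∀ x : X, ContinuousOn (fun t : ℝ => T t x) (Ici 0)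

/-- The (unbounded) operator `A` is the generator of `T`: `x ∈ dom A` and `A x = y` hold exactly
when `(T(h) x - x) / h → y` as `h ↓ 0`. -/
def IsGenerator (T : ℝ → X →L[𝕜] X) (A : X →ₗ.[𝕜] X) : Prop :=
  ∀ x y : X, (x, y) ∈ A.graph ↔
    Tendsto (fun h : ℝ => ((h⁻¹ : ℝ) : 𝕜) • (T h x - x)) (𝓝[>] 0) (𝓝 y)

/-- All orbits `t ↦ T(t) x` are differentiable on `(0, ∞)`. -/
def ImmediatelyDifferentiable (T : ℝ → X →L[𝕜] X) : Prop :=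
  letI : NormedSpace ℝ X := NormedSpace.restrictScalars ℝ 𝕜 X
  ∀ x : X, DifferentiableOn ℝ (fun t : ℝ => T t x) (Ioi 0)

/-- For an embedding `ι : V → X`: the operator `L : Y → X` has range in `V`, and as an operator
`Y → V` it is bounded with norm at most `M`. -/
def BoundedInto (ι : V →L[𝕜] X) (L : Y →L[𝕜] X) (M : ℝ) : Prop :=
  ∃ L' : Y →L[𝕜] V, ι ∘L L' = L ∧ ‖L'‖ ≤ M

open Classical in
/-- The value `B x`, extended by `0` outside `dom B` so that it can be written under an integral. -/
def total (B : X →ₗ.[𝕜] X) (x : X) : X :=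
  if h : x ∈ B.domain then B ⟨x, h⟩ else 0

end UltraPerturb

end

/-!
Extend `B` to a linear operator on all of `X`. Since `T` is smoothing, (S2) makes
`(F W)(t) x = ∫₀ᵗ W(t - s) B T(s) x ds` a Volterra operator of norm at most `q < 1` on strongly
continuous families `W` on `[0, τ]`, and the Dyson–Phillips series `S = ∑ₙ Fⁿ T` converges. Its sum
satisfies the Duhamel formula, which determines `S` uniquely; uniqueness gives the semigroup law,
and differentiation at `0` shows that the generator of `S` extends `A + B`. After rescaling by a
large `μ`, `A + B - μ` is surjective while the generator is injective, so they agree.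

For the bound from `X` to `V`, choose `τ` so small that `κ(s) = C s^(-β)` has integral at most
`1 / 2` over `(0, τ]`; then `Fⁿ T` maps `V` to `V` with norm at most `C / 2ⁿ`. For the norms from
`X` to `V`, split the integral at `s = δ t`. On `(0, δ t)` the factor `t - s ≥ (1 - δ) t` keeps the
singularity `t^(-α)` away and (S2) contributes the ratio `q (1 - δ)^(-α)`, which is smaller than `1`
for small `δ`. On `(δ t, t)` the operator `B T(s) = B T(s / 2) T(s / 2)` already maps `X` to `V`
with norm of order `κ(s) s^(-α)`, and the decay on `V` takes over. Hence the constants in front of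
`t^(-α)` are summable. Separability of `V`, or closedness of its unit ball, is what allows the
integrals to be estimated in `V`.
-/

open MeasureTheory
open scoped BoundedContinuousFunction

noncomputable section

namespace UltraPerturb

section ImageBall

variable {𝕜 X V Y : Type*} [RCLike 𝕜]
  [NormedAddCommGroup X] [NormedSpace 𝕜 X] [NormedAddCommGroup V] [NormedSpace 𝕜 V]
  [NormedAddCommGroup Y] [NormedSpace 𝕜 Y]
  {ι : V →L[𝕜] X} {r r' : ℝ} {x y : X}

/-- The image under the embedding `ι : V → X` of the closed ball of radius `r` around the origin of
`V`. If `ι` is injective, then `x ∈ imageBall ι r` says that `x ∈ V` with `‖x‖_V ≤ r`. -/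
def imageBall (ι : V →L[𝕜] X) (r : ℝ) : Set X :=
  ι '' Metric.closedBall 0 r

theorem mem_imageBall : x ∈ imageBall ι r ↔ ∃ v, ι v = x ∧ ‖v‖ ≤ r := by
  simp only [imageBall, mem_image, mem_closedBall_zero_iff, and_comm]

theorem imageBall_mono (h : r ≤ r') : imageBall ι r ⊆ imageBall ι r' :=
  image_mono (Metric.closedBall_subset_closedBall h)

theorem add_mem_imageBall (hx : x ∈ imageBall ι r) (hy : y ∈ imageBall ι r') :
    x + y ∈ imageBall ι (r + r') := by
  rw [mem_imageBall] at *
  obtain ⟨v, rfl, hv⟩ := hx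
  obtain ⟨w, rfl, hw⟩ := hy
  exact ⟨v + w, map_add ι v w, norm_add_le_of_le hv hw⟩

theorem smul_mem_imageBall (hx : x ∈ imageBall ι r) (c : 𝕜) : c • x ∈ imageBall ι (‖c‖ * r) := by
  rw [mem_imageBall] at *
  obtain ⟨v, rfl, hv⟩ := hx
  exact ⟨c • v, map_smul ι c v, by rw [norm_smul]; gcongr⟩

theorem map_mem_imageBall {L : X → X} {c : ℝ} (hL : ∀ v, L (ι v) ∈ imageBall ι (c * ‖v‖))
    (hc : 0 ≤ c) (hx : x ∈ imageBall ι r) : L x ∈ imageBall ι (c * r) := by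
  obtain ⟨v, rfl, hv⟩ := mem_imageBall.1 hx
  exact imageBall_mono (by gcongr) (hL v)

theorem hasSum_mem_imageBall [CompleteSpace V] {f : ℕ → X} {a : ℕ → ℝ} {s : ℝ}
    (hf : ∀ n, f n ∈ imageBall ι (a n)) (ha : HasSum a s) (hx : HasSum f x) :
    x ∈ imageBall ι s := by
  simp only [mem_imageBall] at *
  choose v hv hva using hf
  have hv_summable : Summable v := .of_norm_bounded ha.summable hva
  refine ⟨∑' n, v n, ?_, tsum_of_norm_bounded ha hva⟩
  exact (ι.hasSum hv_summable.hasSum).unique (by simpa only [hv] using hx)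

protected theorem BoundedInto.mem_imageBall {L : Y →L[𝕜] X} {M : ℝ} (hL : BoundedInto ι L M)
    (y : Y) : L y ∈ imageBall ι (M * ‖y‖) := by
  obtain ⟨L', rfl, hL'⟩ := hL
  exact mem_imageBall.2 ⟨L' y, rfl, L'.le_of_opNorm_le hL' y⟩

theorem boundedInto_of_forall_mem_imageBall (hι : Function.Injective ι) {L : Y →L[𝕜] X} {M : ℝ}
    (hM : 0 ≤ M) (h : ∀ y, L y ∈ imageBall ι (M * ‖y‖)) : BoundedInto ι L M := by
  simp only [mem_imageBall] at h
  choose f hf hfM using h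
  refine ⟨LinearMap.mkContinuous ⟨⟨f, fun y z => hι ?_⟩, fun c y => hι ?_⟩ M hfM, ?_,
    LinearMap.mkContinuous_norm_le _ hM _⟩
  · simp only [map_add, hf]
  · simp only [map_smul, hf, RingHom.id_apply]
  · ext y
    exact hf y

theorem ofReal_smul_mem_imageBall {c : ℝ} (hc : 0 ≤ c) (hx : x ∈ imageBall ι r) :
    (c : 𝕜) • x ∈ imageBall ι (c * r) := by
  simpa only [RCLike.norm_of_nonneg hc] using smul_mem_imageBall hx (c : 𝕜)

theorem isClosed_setOf_mem_imageBall (hV : IsClosed (imageBall ι 1)) :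
    IsClosed {p : X × ℝ | p.1 ∈ imageBall ι p.2} := by
  refine IsSeqClosed.isClosed fun p p₀ hp hlim => ?_
  have hlim_fst : Tendsto (fun n => (p n).1) atTop (𝓝 p₀.1) := (continuous_fst.tendsto _).comp hlim
  have hlim_snd : Tendsto (fun n => (p n).2) atTop (𝓝 p₀.2) := (continuous_snd.tendsto _).comp hlim
  choose v hv hvr using fun n => mem_imageBall.1 (hp n)
  have hr₀ : 0 ≤ p₀.2 := ge_of_tendsto' hlim_snd fun n => (norm_nonneg _).trans (hvr n)
  rcases hr₀.eq_or_lt with hr₀ | hr₀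
  · have hv_zero : Tendsto v atTop (𝓝 0) := squeeze_zero_norm hvr (hr₀ ▸ hlim_snd)
    have hlim_zero : Tendsto (fun n => (p n).1) atTop (𝓝 (ι 0)) := by
      simpa only [Function.comp_def, hv] using (ι.continuous.tendsto 0).comp hv_zero
    exact mem_imageBall.2 ⟨0, tendsto_nhds_unique hlim_zero hlim_fst, norm_zero.trans_le hr₀.le⟩
  · have hmem : ((p₀.2⁻¹ : ℝ) : 𝕜) • p₀.1 ∈ imageBall ι 1 := by
      refine hV.mem_of_tendsto
        (((RCLike.continuous_ofReal.tendsto _).comp (hlim_snd.inv₀ hr₀.ne')).smul hlim_fst) ?_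
      filter_upwards [hlim_snd.eventually (lt_mem_nhds hr₀)] with n hn
      simpa only [Function.comp_apply, inv_mul_cancel₀ hn.ne'] using
        ofReal_smul_mem_imageBall (inv_nonneg.2 hn.le) (hp n)
    have hsmul := ofReal_smul_mem_imageBall hr₀.le hmem
    rwa [smul_smul, ← RCLike.ofReal_mul, mul_inv_cancel₀ hr₀.ne', RCLike.ofReal_one, one_smul,
      mul_one] at hsmul

variable {Ω : Type*} [MeasurableSpace Ω] {μ : Measure Ω} {f : Ω → X} {φ : Ω → ℝ}

theorem integral_mem_imageBall_of_separable [NormedSpace ℝ X] [CompleteSpace X]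
    [CompleteSpace V] [TopologicalSpace.SeparableSpace V]
    (hι : Function.Injective ι) (hf : Integrable f μ) (hφ : Integrable φ μ)
    (h : ∀ᵐ ω ∂μ, f ω ∈ imageBall ι (φ ω)) :
    ∫ ω, f ω ∂μ ∈ imageBall ι (∫ ω, φ ω ∂μ) := by
  let : NormedSpace ℝ V := NormedSpace.restrictScalars ℝ 𝕜 V
  borelize X V
  have := UniformSpace.secondCountable_of_separable V
  obtain ⟨g, hg⟩ : ∃ g : Ω → V, ∀ᵐ ω ∂μ, ι (g ω) = f ω ∧ ‖g ω‖ ≤ φ ω := by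
    simpa only [mem_imageBall, Filter.skolem] using h
  have hg_meas : AEMeasurable g μ := by
    rw [← (ι.continuous.measurableEmbedding hι).aemeasurable_comp_iff]
    exact hf.aestronglyMeasurable.aemeasurable.congr (hg.mono fun ω hω => hω.1.symm)
  have hg_int : Integrable g μ :=
    hφ.mono' hg_meas.aestronglyMeasurable (hg.mono fun ω hω => hω.2)
  have hg_integral : ι (∫ ω, g ω ∂μ) = ∫ ω, f ω ∂μ := by
    rw [← ι.integral_comp_comm hg_int]
    exact integral_congr_ae (hg.mono fun ω hω => hω.1)
  exact mem_imageBall.2 ⟨_, hg_integral, norm_integral_le_of_norm_le hφ (hg.mono fun ω hω => hω.2)⟩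

variable [NormedSpace ℝ X] [IsScalarTower ℝ 𝕜 X]

theorem smul_mem_imageBall_of_nonneg {c : ℝ} (hc : 0 ≤ c) (hx : x ∈ imageBall ι r) :
    c • x ∈ imageBall ι (c * r) := by
  rw [RCLike.real_smul_eq_coe_smul (K := 𝕜)]
  exact ofReal_smul_mem_imageBall hc hx

theorem convex_setOf_mem_imageBall : Convex ℝ {p : X × ℝ | p.1 ∈ imageBall ι p.2} :=
  fun _ hp _ hp' _ _ hc hd _ =>
    add_mem_imageBall (smul_mem_imageBall_of_nonneg hc hp) (smul_mem_imageBall_of_nonneg hd hp')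

variable [CompleteSpace X]

theorem integral_mem_imageBall_of_isClosed [IsFiniteMeasure μ] (hV : IsClosed (imageBall ι 1))
    (hf : Integrable f μ) (hφ : Integrable φ μ) (h : ∀ᵐ ω ∂μ, f ω ∈ imageBall ι (φ ω)) :
    ∫ ω, f ω ∂μ ∈ imageBall ι (∫ ω, φ ω ∂μ) := by
  rcases eq_zero_or_neZero μ with rfl | _
  · exact mem_imageBall.2 ⟨0, by simp⟩
  · have haverage := convex_setOf_mem_imageBall.average_mem (isClosed_setOf_mem_imageBall hV) h
      (hf.prodMk hφ)
    have hsmul : μ.real univ • ⨍ ω, (f ω, φ ω) ∂μ ∈ {p : X × ℝ | p.1 ∈ imageBall ι p.2} :=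
      smul_mem_imageBall_of_nonneg measureReal_nonneg haverage
    rwa [measure_smul_average, integral_pair hf hφ] at hsmul

theorem integral_mem_imageBall [CompleteSpace V] [IsFiniteMeasure μ] (hι : Function.Injective ι)
    (hV : TopologicalSpace.SeparableSpace V ∨ IsClosed (imageBall ι 1))
    (hf : Integrable f μ) (hφ : Integrable φ μ) (h : ∀ᵐ ω ∂μ, f ω ∈ imageBall ι (φ ω)) :
    ∫ ω, f ω ∂μ ∈ imageBall ι (∫ ω, φ ω ∂μ) := by
  rcases hV with hV | hV
  · exact integral_mem_imageBall_of_separable hι hf hφ h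
  · exact integral_mem_imageBall_of_isClosed hV hf hφ h

end ImageBall

section StronglyContinuous

variable {𝕜 X Y Ω : Type*} [RCLike 𝕜] [NormedAddCommGroup X] [NormedSpace 𝕜 X]
  [NormedAddCommGroup Y] [NormedSpace 𝕜 Y] [CompleteSpace X] [TopologicalSpace Ω]
  {W : Ω → X →L[𝕜] Y} {K : Set Ω}

theorem exists_norm_le_of_continuousOn_orbit (hK : IsCompact K)
    (hW : ∀ x, ContinuousOn (fun t => W t x) K) : ∃ M, 0 ≤ M ∧ ∀ t ∈ K, ‖W t‖ ≤ M := by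
  have hpointwise : ∀ x, ∃ C, ∀ t : K, ‖W t x‖ ≤ C := fun x =>
    (hK.exists_bound_of_continuousOn (hW x)).imp fun C hC t => hC t t.2
  obtain ⟨M, hM⟩ := banach_steinhaus hpointwise
  exact ⟨max M 0, le_max_right _ _, fun t ht => (hM ⟨t, ht⟩).trans (le_max_left _ _)⟩

theorem continuousOn_uncurry_of_continuousOn_orbit (hK : IsCompact K)
    (hW : ∀ x, ContinuousOn (fun t => W t x) K) :
    ContinuousOn (fun p : Ω × X => W p.1 p.2) (K ×ˢ univ) := by
  obtain ⟨M, -, hM⟩ := exists_norm_le_of_continuousOn_orbit hK hW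
  refine continuousOn_prod_of_continuousOn_lipschitzOnWith' _ M.toNNReal (fun t ht => ?_)
    fun x _ => hW x
  exact ((W t).lipschitz.weaken (NNReal.coe_le_coe.1 ((hM t ht).trans
    (Real.le_coe_toNNReal M)))).lipschitzOnWith

theorem continuousOn_pow_orbit {W : Ω → X →L[𝕜] X} (hK : IsCompact K)
    (hW : ∀ x, ContinuousOn (fun t => W t x) K) (n : ℕ) (x : X) :
    ContinuousOn (fun t => (W t ^ n) x) K := by
  induction n with
  | zero => exact continuousOn_const
  | succ n ih =>
    simp only [pow_succ', mul_apply_eq_comp]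
    exact (continuousOn_uncurry_of_continuousOn_orbit hK hW).comp (continuousOn_id.prodMk ih)
      fun t ht => ⟨ht, mem_univ _⟩

end StronglyContinuous

section LocalSemigroup

variable {𝕜 X : Type*} [RCLike 𝕜] [NormedAddCommGroup X] [NormedSpace 𝕜 X]
  {U : ℝ → X →L[𝕜] X} {τ : ℝ}

/-- A strongly continuous semigroup that is only defined for times in `[0, τ]`. -/
structure IsLocalC0Semigroup (U : ℝ → X →L[𝕜] X) (τ : ℝ) : Prop where
  map_zero : U 0 = 1
  map_add : ∀ s t : ℝ, 0 ≤ s → 0 ≤ t → s + t ≤ τ → U (s + t) = U s * U t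
  continuousOn_orbit : ∀ x : X, ContinuousOn (fun t : ℝ => U t x) (Icc 0 τ)

namespace IsLocalC0Semigroup

theorem commute (hU : IsLocalC0Semigroup U τ) {s t : ℝ} (hs : 0 ≤ s) (ht : 0 ≤ t)
    (hst : s + t ≤ τ) : Commute (U s) (U t) := by
  rw [commute_iff_eq, ← hU.map_add s t hs ht hst, add_comm, hU.map_add t s ht hs (by linarith)]

theorem map_natCast_mul (hU : IsLocalC0Semigroup U τ) {h : ℝ} (hh : 0 ≤ h) (n : ℕ)
    (hn : n * h ≤ τ) : U (n * h) = U h ^ n := by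
  induction n with
  | zero => simpa using hU.map_zero
  | succ n ih =>
    rw [Nat.cast_succ, add_one_mul] at hn ⊢
    rw [hU.map_add _ _ (by positivity) hh hn, ih (by linarith), pow_succ]

theorem pow_div_eq (hU : IsLocalC0Semigroup U τ) {t : ℝ} (ht : 0 ≤ t) {m n : ℕ} (hm : m ≠ 0)
    (hn : n ≠ 0) (htm : t ≤ m * τ) (htn : t ≤ n * τ) : U (t / m) ^ m = U (t / n) ^ n := by
  have hrefine : ∀ {m n : ℕ}, m ≠ 0 → n ≠ 0 → t ≤ m * τ →
      U (t / m) ^ m = U (t / (n * m)) ^ (n * m) := by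
    intro m n hm hn htm
    have hm' : (0 : ℝ) < m := by positivity
    have hdiv : t / m = n * (t / (n * m)) := by field_simp
    have hle : n * (t / (n * m)) ≤ τ := by rwa [← hdiv, div_le_iff₀ hm', mul_comm]
    rw [hdiv, hU.map_natCast_mul (by positivity) n hle, pow_mul]
  rw [hrefine hm hn htm, hrefine hn hm htn, mul_comm n m, mul_comm (n : ℝ)]

theorem exists_extension [CompleteSpace X] (hU : IsLocalC0Semigroup U τ) (hτ : 0 < τ) :
    ∃ S : ℝ → X →L[𝕜] X, IsC0Semigroup S ∧ EqOn S U (Icc 0 τ) := by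
  obtain ⟨S, hS⟩ : ∃ S : ℝ → X →L[𝕜] X,
      ∀ (n : ℕ) (t : ℝ), n ≠ 0 → 0 ≤ t → t ≤ n * τ → S t = U (t / n) ^ n := by
    refine ⟨fun t => U (t / (⌈t / τ⌉₊ + 1 : ℕ)) ^ (⌈t / τ⌉₊ + 1), fun n t hn ht htn => ?_⟩
    refine hU.pow_div_eq ht (Nat.succ_ne_zero _) hn ?_ htn
    rw [← div_le_iff₀ hτ]
    exact (Nat.le_ceil _).trans (by push_cast; linarith)
  have hS_eq : EqOn S U (Icc 0 τ) := fun t ht => by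
    simpa using hS 1 t one_ne_zero ht.1 (by simpa using ht.2)
  refine ⟨S, ⟨?_, fun s t hs ht => ?_, fun x t ht => ?_⟩, hS_eq⟩
  · rw [hS_eq ⟨le_rfl, hτ.le⟩, hU.map_zero, ContinuousLinearMap.one_def]
  · obtain ⟨n, hn⟩ := exists_nat_gt ((s + t) / τ)
    have hn_pos : (0 : ℝ) < n := lt_of_le_of_lt (by positivity) hn
    have hn_ne : n ≠ 0 := by exact_mod_cast hn_pos.ne'
    have hst : s + t ≤ n * τ := ((div_lt_iff₀ hτ).1 hn).le
    have hst_div : s / n + t / n ≤ τ := by rwa [← add_div, div_le_iff₀ hn_pos, mul_comm]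
    rw [hS n _ hn_ne (by positivity) hst, hS n s hn_ne hs (by linarith),
      hS n t hn_ne ht (by linarith), add_div, hU.map_add _ _ (by positivity) (by positivity)
      hst_div, (hU.commute (by positivity) (by positivity) hst_div).mul_pow,
      ContinuousLinearMap.mul_def]
  · obtain ⟨n, hn⟩ := exists_nat_gt (t / τ)
    have hn_pos : (0 : ℝ) < n := lt_of_le_of_lt (div_nonneg ht hτ.le) hn
    have hcont : ContinuousOn (fun s => S s x) (Icc 0 (n * τ)) := by
      refine ContinuousOn.congr
        ((continuousOn_pow_orbit isCompact_Icc hU.continuousOn_orbit n x).comp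
        (continuous_id.div_const (n : ℝ)).continuousOn fun s hs => ?_) fun s hs => ?_
      · exact ⟨div_nonneg hs.1 hn_pos.le, by rw [id, div_le_iff₀ hn_pos, mul_comm]; exact hs.2⟩
      · rw [hS n s (by exact_mod_cast hn_pos.ne') hs.1 hs.2]
        rfl
    refine (hcont t ⟨ht, ((div_lt_iff₀ hτ).1 hn).le⟩).mono_of_mem_nhdsWithin ?_
    exact inter_mem_nhdsWithin _ (Iic_mem_nhds ((div_lt_iff₀ hτ).1 hn))

end IsLocalC0Semigroup

end LocalSemigroup

section Generator

theorem hasDerivWithinAt_Ici_iff_tendsto {E : Type*} [NormedAddCommGroup E] [NormedSpace ℝ E]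
    {f : ℝ → E} {y : E} {t : ℝ} :
    HasDerivWithinAt f y (Ici t) t ↔
      Tendsto (fun h : ℝ => h⁻¹ • (f (t + h) - f t)) (𝓝[>] 0) (𝓝 y) := by
  rw [← hasDerivWithinAt_Ioi_iff_Ici, hasDerivWithinAt_iff_tendsto_slope' self_notMem_Ioi]
  have hmap : map (fun h : ℝ => t + h) (𝓝[>] 0) = 𝓝[>] t := by simp
  rw [← hmap, tendsto_map'_iff]
  simp only [Function.comp_def, slope, vsub_eq_sub, add_sub_cancel_left]

variable {𝕜 X : Type*} [RCLike 𝕜] [NormedAddCommGroup X] [NormedSpace 𝕜 X]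
  {T S : ℝ → X →L[𝕜] X} {x y : X} {s t τ : ℝ}

/-- The graph of the generator of `T`: all pairs `(x, y)` such that `(T(h) x - x) / h → y` as
`h ↓ 0`. Working with the graph as a subspace of `X × X` avoids partially defined maps. -/
def generatorGraph (T : ℝ → X →L[𝕜] X) : Submodule 𝕜 (X × X) where
  carrier := {p | Tendsto (fun h : ℝ => ((h⁻¹ : ℝ) : 𝕜) • (T h p.1 - p.1)) (𝓝[>] 0) (𝓝 p.2)}
  add_mem' {p p'} hp hp' := (Tendsto.add hp hp').congr fun h => by
    rw [← smul_add, Prod.fst_add, map_add, add_sub_add_comm]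
  zero_mem' := by simp
  smul_mem' c p hp := (Tendsto.const_smul hp c).congr fun h => by
    rw [smul_comm, smul_sub, Prod.smul_fst, map_smul]

theorem isGenerator_iff_graph_eq {A : X →ₗ.[𝕜] X} :
    IsGenerator T A ↔ A.graph = generatorGraph T := by
  rw [SetLike.ext_iff, Prod.forall]
  rfl

namespace IsC0Semigroup

theorem zero_apply (hT : IsC0Semigroup T) (x : X) : T 0 x = x := by
  rw [hT.map_zero, ContinuousLinearMap.id_apply]

theorem add_apply (hT : IsC0Semigroup T) (hs : 0 ≤ s) (ht : 0 ≤ t) (x : X) :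
    T (s + t) x = T s (T t x) := by
  rw [hT.map_add s t hs ht, ContinuousLinearMap.comp_apply]

theorem commute_apply (hT : IsC0Semigroup T) (hs : 0 ≤ s) (ht : 0 ≤ t) (x : X) :
    T s (T t x) = T t (T s x) := by
  rw [← hT.add_apply hs ht, ← hT.add_apply ht hs, add_comm]

theorem isLocalC0Semigroup (hT : IsC0Semigroup T) (τ : ℝ) : IsLocalC0Semigroup T τ where
  map_zero := hT.map_zero
  map_add s t hs ht _ := hT.map_add s t hs ht
  continuousOn_orbit x := (hT.continuousOn_orbit x).mono Icc_subset_Ici_self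

theorem tendsto_orbit_zero (hT : IsC0Semigroup T) (x : X) :
    Tendsto (fun h => T h x) (𝓝[>] 0) (𝓝 x) := by
  have hcont := (hT.continuousOn_orbit x 0 self_mem_Ici).mono Ioi_subset_Ici_self
  rwa [ContinuousWithinAt, hT.zero_apply] at hcont

theorem intervalIntegrable_orbit (hT : IsC0Semigroup T) (x : X) (hs : 0 ≤ s) (ht : 0 ≤ t) :
    IntervalIntegrable (fun r => T r x) volume s t :=
  ((hT.continuousOn_orbit x).mono fun _ hr => (le_min hs ht).trans hr.1).intervalIntegrable

theorem hasDerivWithinAt_integral_orbit [NormedSpace ℝ X] [CompleteSpace X]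
    (hT : IsC0Semigroup T) (x : X) (ht : 0 ≤ t) :
    HasDerivWithinAt (fun u => ∫ s in 0..u, T s x) (T t x) (Ici t) t := by
  have hcont : ContinuousOn (fun s => T s x) (Ici t) :=
    (hT.continuousOn_orbit x).mono (Ici_subset_Ici.2 ht)
  refine intervalIntegral.integral_hasDerivWithinAt_right
    (hT.intervalIntegrable_orbit x le_rfl ht) (t := Ioi t) ?_
    ((hcont t self_mem_Ici).mono Ioi_subset_Ici_self)
  exact ⟨Ioi t, self_mem_nhdsWithin,
    (hcont.mono Ioi_subset_Ici_self).aestronglyMeasurable measurableSet_Ioi⟩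

end IsC0Semigroup

variable [NormedSpace ℝ X] [IsScalarTower ℝ 𝕜 X]

theorem mem_generatorGraph_iff :
    (x, y) ∈ generatorGraph T ↔ Tendsto (fun h : ℝ => h⁻¹ • (T h x - x)) (𝓝[>] 0) (𝓝 y) := by
  simp only [RCLike.real_smul_eq_coe_smul (K := 𝕜)]
  rfl

theorem IsC0Semigroup.map_mem_generatorGraph (hT : IsC0Semigroup T)
    (h : (x, y) ∈ generatorGraph T) (ht : 0 ≤ t) : (T t x, T t y) ∈ generatorGraph T := by
  rw [mem_generatorGraph_iff] at h ⊢
  refine (((T t).continuous.tendsto y).comp h).congr' ?_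
  filter_upwards [self_mem_nhdsWithin] with r hr
  rw [Function.comp_apply, ContinuousLinearMap.map_smul_of_tower, map_sub,
    hT.commute_apply ht (le_of_lt hr)]

theorem IsC0Semigroup.hasDerivWithinAt_orbit (hT : IsC0Semigroup T)
    (h : (x, y) ∈ generatorGraph T) (ht : 0 ≤ t) :
    HasDerivWithinAt (fun t => T t x) (T t y) (Ici t) t := by
  rw [hasDerivWithinAt_Ici_iff_tendsto]
  refine (mem_generatorGraph_iff.1 (hT.map_mem_generatorGraph h ht)).congr' ?_
  filter_upwards [self_mem_nhdsWithin] with r hr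
  rw [add_comm t r, hT.add_apply (le_of_lt hr) ht]

theorem IsC0Semigroup.integral_orbit_eq_sub [CompleteSpace X] (hT : IsC0Semigroup T)
    (h : (x, y) ∈ generatorGraph T) (ht : 0 ≤ t) : ∫ s in 0..t, T s y = T t x - x := by
  have hderiv : ∀ s ∈ Ioo (min 0 t) (max 0 t),
      HasDerivWithinAt (fun s => T s x) (T s y) (Ioi s) s := fun s hs =>
    (hT.hasDerivWithinAt_orbit h ((le_min le_rfl ht).trans hs.1.le)).mono Ioi_subset_Ici_self
  rw [intervalIntegral.integral_eq_sub_of_hasDeriv_right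
    ((hT.continuousOn_orbit x).mono fun _ hs => (le_min le_rfl ht).trans hs.1) hderiv
    (hT.intervalIntegrable_orbit y le_rfl ht), hT.zero_apply]

theorem IsC0Semigroup.mem_generatorGraph_iff_integral [CompleteSpace X] (hT : IsC0Semigroup T) :
    (x, y) ∈ generatorGraph T ↔ ∀ t, 0 ≤ t → ∫ s in 0..t, T s y = T t x - x := by
  refine ⟨fun h t => hT.integral_orbit_eq_sub h, fun h => ?_⟩
  rw [mem_generatorGraph_iff]
  have hderiv := hasDerivWithinAt_Ici_iff_tendsto.1 (hT.hasDerivWithinAt_integral_orbit y le_rfl)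
  rw [hT.zero_apply] at hderiv
  refine hderiv.congr' ?_
  filter_upwards [self_mem_nhdsWithin] with r hr
  rw [zero_add, intervalIntegral.integral_same, sub_zero, h r (le_of_lt hr)]

theorem IsC0Semigroup.integral_mem_generatorGraph [CompleteSpace X] (hT : IsC0Semigroup T)
    (x : X) (ht : 0 ≤ t) : (∫ s in 0..t, T s x, T t x - x) ∈ generatorGraph T := by
  have hderiv_t := hasDerivWithinAt_Ici_iff_tendsto.1 (hT.hasDerivWithinAt_integral_orbit x ht)
  have hderiv_zero :=
    hasDerivWithinAt_Ici_iff_tendsto.1 (hT.hasDerivWithinAt_integral_orbit x le_rfl)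
  rw [hT.zero_apply] at hderiv_zero
  rw [mem_generatorGraph_iff]
  refine (hderiv_t.sub hderiv_zero).congr' ?_
  filter_upwards [self_mem_nhdsWithin] with h (hh : 0 < h)
  have hshift : T h (∫ s in 0..t, T s x) = ∫ s in h..t + h, T s x := by
    rw [← (T h).intervalIntegral_comp_comm (hT.intervalIntegrable_orbit x le_rfl ht)]
    have hsubst := intervalIntegral.integral_comp_add_right (a := 0) (b := t) (fun s => T s x) h
    rw [zero_add] at hsubst
    rw [← hsubst]
    refine intervalIntegral.integral_congr fun s hs => ?_
    rw [uIcc_of_le ht] at hs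
    rw [add_comm s h, hT.add_apply hh.le hs.1]
  have hsplit := intervalIntegral.integral_add_adjacent_intervals
    (hT.intervalIntegrable_orbit x le_rfl hh.le)
    (hT.intervalIntegrable_orbit x hh.le (add_nonneg ht hh.le))
  rw [← smul_sub, hshift, ← hsplit, zero_add, intervalIntegral.integral_same]
  congr 1
  abel

theorem IsC0Semigroup.dense_fst_generatorGraph [CompleteSpace X] (hT : IsC0Semigroup T) :
    Dense {x | ∃ y, (x, y) ∈ generatorGraph T} := by
  intro x
  have hderiv := hasDerivWithinAt_Ici_iff_tendsto.1 (hT.hasDerivWithinAt_integral_orbit x le_rfl)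
  rw [hT.zero_apply] at hderiv
  refine mem_closure_of_tendsto hderiv ?_
  filter_upwards [self_mem_nhdsWithin] with h hh
  refine ⟨((h⁻¹ : ℝ) : 𝕜) • (T h x - x), ?_⟩
  rw [zero_add, intervalIntegral.integral_same, sub_zero, RCLike.real_smul_eq_coe_smul (K := 𝕜)]
  exact (generatorGraph T).smul_mem _ (hT.integral_mem_generatorGraph x (le_of_lt hh))

theorem IsC0Semigroup.hasDerivWithinAt_comp_orbit [CompleteSpace X] (hT : IsC0Semigroup T)
    (hS : IsC0Semigroup S) (hTS : generatorGraph T ≤ generatorGraph S)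
    (hx : (x, y) ∈ generatorGraph T) (hs : s ∈ Ico 0 t) :
    HasDerivWithinAt (fun s => S (t - s) (T s x)) 0 (Ici s) s := by
  obtain ⟨M, -, hM⟩ := exists_norm_le_of_continuousOn_orbit isCompact_Icc
    (hS.isLocalC0Semigroup t).continuousOn_orbit
  rw [hasDerivWithinAt_Ici_iff_tendsto]
  have hxs := hT.map_mem_generatorGraph hx hs.1
  have hlim := ((mem_generatorGraph_iff.1 hxs).sub
    (mem_generatorGraph_iff.1 (hTS hxs))).norm.const_mul M
  rw [sub_self, norm_zero, mul_zero] at hlim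
  refine squeeze_zero_norm' ?_ hlim
  filter_upwards [Ioo_mem_nhdsGT (sub_pos.2 hs.2)] with r hr
  have htr : 0 ≤ t - (s + r) := by linarith [hr.2]
  have hsplit : t - s = t - (s + r) + r := by ring
  have hquot : r⁻¹ • (S (t - (s + r)) (T (s + r) x) - S (t - s) (T s x)) =
      S (t - (s + r)) (r⁻¹ • (T r (T s x) - T s x) - r⁻¹ • (S r (T s x) - T s x)) := by
    rw [hsplit, hS.add_apply htr hr.1.le, add_comm s r, hT.add_apply hr.1.le hs.1, ← smul_sub,
      ContinuousLinearMap.map_smul_of_tower, sub_sub_sub_cancel_right, map_sub]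
  rw [hquot]
  exact (S (t - (s + r))).le_of_opNorm_le (hM _ ⟨htr, by linarith [hs.1, hr.1]⟩) _

theorem IsC0Semigroup.eq_of_generatorGraph_le [CompleteSpace X] (hT : IsC0Semigroup T)
    (hS : IsC0Semigroup S) (hTS : generatorGraph T ≤ generatorGraph S) (ht : 0 ≤ t) :
    S t = T t := by
  refine ContinuousLinearMap.coeFn_injective
    (Continuous.ext_on hT.dense_fst_generatorGraph (S t).continuous (T t).continuous ?_)
  rintro x ⟨y, hx⟩
  have hcont : ContinuousOn (fun s => S (t - s) (T s x)) (Icc 0 t) :=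
    (continuousOn_uncurry_of_continuousOn_orbit isCompact_Icc
      (hS.isLocalC0Semigroup t).continuousOn_orbit).comp
      ((continuousOn_const.sub continuousOn_id).prodMk
        ((hT.isLocalC0Semigroup t).continuousOn_orbit x))
      fun s hs => ⟨⟨sub_nonneg.2 hs.2, sub_le_self t hs.1⟩, mem_univ _⟩
  have hconst := constant_of_has_deriv_right_zero hcont
    (fun s hs => hT.hasDerivWithinAt_comp_orbit hS hTS hx hs) t (right_mem_Icc.2 ht)
  simpa only [sub_self, sub_zero, hT.zero_apply, hS.zero_apply] using hconst.symm

end Generator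

section StronglyIntegrable

variable {𝕜 X : Type*} [RCLike 𝕜] [NormedAddCommGroup X] [NormedSpace 𝕜 X]
  {F : ℝ → X →ₗ[𝕜] X} {τ τ' q : ℝ}

/-- A family of linear operators `F(s)`, not necessarily bounded, whose orbits are integrable over
`(0, τ]` with `∫ ‖F(s) x‖ ds ≤ q ‖x‖`. For `F(s) = B T(s)` this is Miyadera's condition on `B`. -/
structure IsStronglyIntegrableOn (F : ℝ → X →ₗ[𝕜] X) (τ q : ℝ) : Prop where
  nonneg : 0 ≤ q
  integrableOn : ∀ x, IntegrableOn (fun s => F s x) (Ioc 0 τ)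
  integral_norm_le : ∀ x, ∫ s in Ioc 0 τ, ‖F s x‖ ≤ q * ‖x‖

namespace IsStronglyIntegrableOn

theorem mono (hF : IsStronglyIntegrableOn F τ q) (h : τ' ≤ τ) : IsStronglyIntegrableOn F τ' q where
  nonneg := hF.nonneg
  integrableOn x := (hF.integrableOn x).mono_set (Ioc_subset_Ioc_right h)
  integral_norm_le x := (setIntegral_mono_set (hF.integrableOn x).norm
    (ae_of_all _ fun _ => norm_nonneg _) (Ioc_subset_Ioc_right h).eventuallyLE).trans
    (hF.integral_norm_le x)

variable [NormedSpace ℝ X] [IsScalarTower ℝ 𝕜 X]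

/-- The strong integral `x ↦ ∫ F(s) x ds` over `(0, τ]`, as a bounded operator. -/
def integralCLM (hF : IsStronglyIntegrableOn F τ q) : X →L[𝕜] X :=
  LinearMap.mkContinuous
    { toFun := fun x => ∫ s in Ioc 0 τ, F s x
      map_add' := fun x y => by
        simp only [map_add]
        exact integral_add (hF.integrableOn x) (hF.integrableOn y)
      map_smul' := fun c x => by
        simp only [map_smul, RingHom.id_apply]
        exact integral_smul c _ }
    q fun x => (norm_integral_le_integral_norm _).trans (hF.integral_norm_le x)

theorem integralCLM_apply (hF : IsStronglyIntegrableOn F τ q) (x : X) :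
    hF.integralCLM x = ∫ s in Ioc 0 τ, F s x :=
  rfl

theorem norm_integralCLM_le (hF : IsStronglyIntegrableOn F τ q) : ‖hF.integralCLM‖ ≤ q :=
  LinearMap.mkContinuous_norm_le _ hF.nonneg _

end IsStronglyIntegrableOn

variable [CompleteSpace X] {T : ℝ → X →L[𝕜] X}

theorem IsC0Semigroup.exists_isStronglyIntegrableOn (hT : IsC0Semigroup T) (τ : ℝ) :
    ∃ M, IsStronglyIntegrableOn (fun s => (T s : X →ₗ[𝕜] X)) τ M := by
  obtain ⟨M, hM_nonneg, hM⟩ := exists_norm_le_of_continuousOn_orbit isCompact_Icc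
    (hT.isLocalC0Semigroup τ).continuousOn_orbit
  have hintegrable : ∀ x, IntegrableOn (fun s => T s x) (Ioc 0 τ) := fun x =>
    ((hT.isLocalC0Semigroup τ).continuousOn_orbit x).integrableOn_Icc.mono_set Ioc_subset_Icc_self
  refine ⟨M * volume.real (Ioc 0 τ), by positivity, hintegrable, fun x => ?_⟩
  calc ∫ s in Ioc 0 τ, ‖T s x‖ ≤ ∫ _ in Ioc 0 τ, M * ‖x‖ :=
        setIntegral_mono_on (hintegrable x).norm (integrableOn_const measure_Ioc_lt_top.ne)
          measurableSet_Ioc fun s hs => (T s).le_of_opNorm_le (hM s (Ioc_subset_Icc_self hs)) x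
    _ = M * volume.real (Ioc 0 τ) * ‖x‖ := by rw [setIntegral_const, smul_eq_mul]; ring

variable [NormedSpace ℝ X] [IsScalarTower ℝ 𝕜 X]

theorem IsC0Semigroup.continuous_integral_orbit (hT : IsC0Semigroup T) {t : ℝ} (ht : 0 ≤ t) :
    Continuous fun x => ∫ s in 0..t, T s x := by
  obtain ⟨_, hM⟩ := hT.exists_isStronglyIntegrableOn t
  simp only [intervalIntegral.integral_of_le ht]
  exact hM.integralCLM.continuous

theorem IsC0Semigroup.isClosed_generatorGraph (hT : IsC0Semigroup T) :
    IsClosed (generatorGraph T : Set (X × X)) := by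
  have hgraph : (generatorGraph T : Set (X × X)) =
      ⋂ t : ℝ, ⋂ _ : 0 ≤ t, {p | ∫ s in 0..t, T s p.2 = T t p.1 - p.1} := by
    ext p
    simp only [mem_iInter]
    exact hT.mem_generatorGraph_iff_integral
  rw [hgraph]
  exact isClosed_iInter fun t => isClosed_iInter fun ht =>
    isClosed_eq ((hT.continuous_integral_orbit ht).comp continuous_snd) (by fun_prop)

end StronglyIntegrable

section Rescale

variable {𝕜 X : Type*} [RCLike 𝕜] [NormedAddCommGroup X] [NormedSpace 𝕜 X]
  {T : ℝ → X →L[𝕜] X} {x y : X} {t μ : ℝ}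

/-- The rescaled family `e^{-μ t} T(t)`, whose generator is that of `T` shifted by `-μ`. -/
def rescale (μ : ℝ) (T : ℝ → X →L[𝕜] X) (t : ℝ) : X →L[𝕜] X :=
  (Real.exp (-μ * t) : 𝕜) • T t

theorem rescale_neg_rescale : rescale (-μ) (rescale μ T) = T := by
  funext t
  rw [rescale, rescale, smul_smul, ← RCLike.ofReal_mul, ← Real.exp_add]
  simp

theorem norm_rescale : ‖rescale μ T t‖ = Real.exp (-μ * t) * ‖T t‖ := by
  rw [rescale, norm_smul, RCLike.norm_of_nonneg (Real.exp_nonneg _)]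

theorem exists_norm_rescale_lt (T : ℝ → X →L[𝕜] X) (ht : 0 < t) {ε : ℝ} (hε : 0 < ε) :
    ∃ μ₀, ∀ μ, μ₀ ≤ μ → ‖rescale μ T t‖ < ε := by
  have hlim : Tendsto (fun μ => ‖rescale μ T t‖) atTop (𝓝 0) := by
    simp only [norm_rescale]
    have hexp : Tendsto (fun μ : ℝ => Real.exp (-μ * t)) atTop (𝓝 0) :=
      Real.tendsto_exp_atBot.comp (tendsto_neg_atTop_atBot.atBot_mul_const ht)
    simpa only [zero_mul] using hexp.mul_const ‖T t‖
  exact eventually_atTop.1 (hlim.eventually (gt_mem_nhds hε))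

theorem IsC0Semigroup.rescale (hT : IsC0Semigroup T) (μ : ℝ) : IsC0Semigroup (rescale μ T) where
  map_zero := by simp [UltraPerturb.rescale, hT.map_zero]
  map_add s t hs ht := by
    simp only [UltraPerturb.rescale, hT.map_add s t hs ht, ContinuousLinearMap.comp_smul,
      ContinuousLinearMap.smul_comp, smul_smul, ← RCLike.ofReal_mul, ← Real.exp_add]
    ring_nf
  continuousOn_orbit x := by
    have hcont : Continuous fun t : ℝ => (Real.exp (-μ * t) : 𝕜) :=
      RCLike.continuous_ofReal.comp (by fun_prop)
    exact hcont.continuousOn.smul (hT.continuousOn_orbit x)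

theorem sub_smul_mem_generatorGraph_rescale (h : (x, y) ∈ generatorGraph T) (μ : ℝ) :
    (x, y - (μ : 𝕜) • x) ∈ generatorGraph (rescale μ T) := by
  have hexp : Tendsto (fun h : ℝ => ((Real.exp (-μ * h) : ℝ) : 𝕜)) (𝓝[>] 0) (𝓝 1) := by
    have hcont : Continuous fun h : ℝ => ((Real.exp (-μ * h) : ℝ) : 𝕜) :=
      RCLike.continuous_ofReal.comp (by fun_prop)
    simpa using hcont.tendsto' 0 1 (by simp) |>.mono_left nhdsWithin_le_nhds
  have hslope : Tendsto (fun h : ℝ => ((h⁻¹ * (Real.exp (-μ * h) - 1) : ℝ) : 𝕜)) (𝓝[>] 0)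
      (𝓝 ((-μ : ℝ) : 𝕜)) := by
    have hderiv : HasDerivAt (fun h : ℝ => Real.exp (-μ * h)) (-μ) 0 := by
      simpa using ((hasDerivAt_id (0 : ℝ)).const_mul (-μ)).exp
    refine (RCLike.continuous_ofReal.tendsto _).comp ?_
    simpa using hasDerivWithinAt_Ici_iff_tendsto.1 hderiv.hasDerivWithinAt
  have hlim := (hexp.smul h).add (hslope.smul_const x)
  rw [one_smul, RCLike.ofReal_neg, neg_smul, ← sub_eq_add_neg] at hlim
  refine hlim.congr fun h => ?_
  rw [rescale, smul_apply]
  push_cast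
  module

theorem mem_generatorGraph_rescale_iff :
    (x, y) ∈ generatorGraph (rescale μ T) ↔ (x, y + (μ : 𝕜) • x) ∈ generatorGraph T := by
  constructor <;> intro h
  · simpa [rescale_neg_rescale] using sub_smul_mem_generatorGraph_rescale h (-μ)
  · simpa using sub_smul_mem_generatorGraph_rescale h μ

end Rescale

section RelativelyBounded

variable {𝕜 X : Type*} [RCLike 𝕜] [NormedAddCommGroup X] [NormedSpace 𝕜 X]
  {T : ℝ → X →L[𝕜] X} {B : X →ₗ[𝕜] X} {x y : X} {s t ε τ q : ℝ}

/-- `B` is bounded with respect to the graph norm on the domain of the generator of `T`. -/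
def IsRelativelyBounded (T : ℝ → X →L[𝕜] X) (B : X →ₗ[𝕜] X) : Prop :=
  ∃ K, ∀ p ∈ generatorGraph T, ‖B p.1‖ ≤ K * ‖p‖

namespace IsRelativelyBounded

/-- The restriction of a relatively bounded operator to the domain of the generator, with the graph
norm. -/
def graphCLM (hB : IsRelativelyBounded T B) : generatorGraph T →L[𝕜] X :=
  LinearMap.mkContinuousOfExistsBound
    (B ∘ₗ LinearMap.fst 𝕜 X X ∘ₗ (generatorGraph T).subtype)
    (hB.imp fun _ hK p => hK p p.2)

theorem graphCLM_apply (hB : IsRelativelyBounded T B) (p : generatorGraph T) :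
    hB.graphCLM p = B (p : X × X).1 :=
  rfl

theorem continuousOn (hB : IsRelativelyBounded T B) :
    ContinuousOn (fun p : X × X => B p.1) (generatorGraph T) :=
  continuousOn_iff_continuous_domRestrict.2 hB.graphCLM.continuous

protected theorem rescale (hB : IsRelativelyBounded T B) (μ : ℝ) :
    IsRelativelyBounded (rescale μ T) B := by
  obtain ⟨K, hK⟩ := hB
  let shift : X × X →L[𝕜] X × X :=
    (ContinuousLinearMap.fst 𝕜 X X).prod
      (ContinuousLinearMap.snd 𝕜 X X + (μ : 𝕜) • ContinuousLinearMap.fst 𝕜 X X)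
  refine ⟨|K| * ‖shift‖, fun p hp => ?_⟩
  calc ‖B p.1‖ ≤ K * ‖shift p‖ := hK (shift p) (mem_generatorGraph_rescale_iff.1 hp)
    _ ≤ |K| * (‖shift‖ * ‖p‖) := by gcongr; exacts [le_abs_self K, shift.le_opNorm p]
    _ = |K| * ‖shift‖ * ‖p‖ := (mul_assoc _ _ _).symm

variable [NormedSpace ℝ X] [IsScalarTower ℝ 𝕜 X]

theorem tendsto_orbit (hB : IsRelativelyBounded T B) (hT : IsC0Semigroup T)
    (h : (x, y) ∈ generatorGraph T) : Tendsto (fun s => B (T s x)) (𝓝[>] 0) (𝓝 (B x)) := by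
  have hlim : Tendsto (fun s => (T s x, T s y)) (𝓝[>] 0) (𝓝[generatorGraph T] (x, y)) := by
    refine tendsto_nhdsWithin_iff.2
      ⟨(hT.tendsto_orbit_zero x).prodMk_nhds (hT.tendsto_orbit_zero y), ?_⟩
    filter_upwards [self_mem_nhdsWithin] with s hs
    exact hT.map_mem_generatorGraph h (le_of_lt hs)
  exact (hB.continuousOn _ h).tendsto.comp hlim

theorem continuousOn_orbit (hB : IsRelativelyBounded T B) (hT : IsC0Semigroup T)
    (h : (T ε x, y) ∈ generatorGraph T) (hε : 0 ≤ ε) :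
    ContinuousOn (fun s => B (T s x)) (Ici ε) := by
  have hcont : ContinuousOn (fun s => (T (s - ε) (T ε x), T (s - ε) y)) (Ici ε) :=
    ((hT.continuousOn_orbit (T ε x)).prodMk (hT.continuousOn_orbit y)).comp
      (continuousOn_id.sub continuousOn_const) fun s hs => mem_Ici.2 (sub_nonneg.2 hs)
  refine (hB.continuousOn.comp hcont fun s hs => ?_).congr fun s hs => ?_
  · exact hT.map_mem_generatorGraph h (sub_nonneg.2 hs)
  · rw [Function.comp_apply, ← hT.add_apply (sub_nonneg.2 hs) hε, sub_add_cancel]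

variable [CompleteSpace X]

theorem map_integral_orbit (hB : IsRelativelyBounded T B) (hT : IsC0Semigroup T)
    (h : (x, y) ∈ generatorGraph T) (ht : 0 ≤ t) :
    B (∫ s in 0..t, T s x) = ∫ s in 0..t, B (T s x) := by
  have : CompleteSpace (generatorGraph T) := hT.isClosed_generatorGraph.completeSpace_coe
  let orbit : ℝ → generatorGraph T := fun s =>
    ⟨(T (max s 0) x, T (max s 0) y), hT.map_mem_generatorGraph h (le_max_right s 0)⟩
  have horbit : Continuous orbit := by
    refine Continuous.subtype_mk (Continuous.prodMk ?_ ?_) _ <;>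
    exact (hT.continuousOn_orbit _).comp_continuous (by fun_prop) fun s => le_max_right s 0
  have horbit_eq : ∀ s ∈ uIcc 0 t, (orbit s : X × X).1 = T s x := fun s hs => by
    rw [uIcc_of_le ht] at hs
    simp only [orbit, max_eq_left hs.1]
  let domainCLM : generatorGraph T →L[𝕜] X :=
    ContinuousLinearMap.fst 𝕜 X X ∘L (generatorGraph T).subtypeL
  have hfst := domainCLM.intervalIntegral_comp_comm (horbit.intervalIntegrable (μ := volume) 0 t)
  have hgraph := hB.graphCLM.intervalIntegral_comp_comm
    (horbit.intervalIntegrable (μ := volume) 0 t)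
  calc B (∫ s in 0..t, T s x) = B (domainCLM (∫ s in 0..t, orbit s)) := by
        rw [← hfst, intervalIntegral.integral_congr fun s hs => (horbit_eq s hs).symm]
        rfl
    _ = ∫ s in 0..t, hB.graphCLM (orbit s) := hgraph.symm
    _ = ∫ s in 0..t, B (T s x) := intervalIntegral.integral_congr fun s hs => by
        simp only [graphCLM_apply, horbit_eq s hs]

theorem map_integral_orbit_of_isStronglyIntegrableOn (hB : IsRelativelyBounded T B)
    (hT : IsC0Semigroup T)
    (hBT : IsStronglyIntegrableOn (fun s => B ∘ₗ (T s : X →ₗ[𝕜] X)) t q) (ht : 0 ≤ t) (x : X) :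
    B (∫ s in 0..t, T s x) = hBT.integralCLM x := by
  have hcont : Continuous fun x => B (∫ s in 0..t, T s x) :=
    hB.continuousOn.comp_continuous
      ((hT.continuous_integral_orbit ht).prodMk ((T t).continuous.sub continuous_id))
      fun x => hT.integral_mem_generatorGraph x ht
  refine congrFun (hcont.ext_on hT.dense_fst_generatorGraph hBT.integralCLM.continuous ?_) x
  rintro z ⟨y, h⟩
  beta_reduce
  rw [hB.map_integral_orbit hT h ht, hBT.integralCLM_apply, intervalIntegral.integral_of_le ht]
  rfl

end IsRelativelyBounded

end RelativelyBounded

section Smoothing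

theorem integrableOn_Ioc_and_integral_norm_le_of_tendsto {E : Type*} [NormedAddCommGroup E]
    {f : ℝ → E} {φ : ℝ → ℝ} {τ c : ℝ} (hτ : 0 < τ) (hf : ∀ ε, 0 < ε → IntegrableOn f (Ioc ε τ))
    (hφ : Tendsto φ (𝓝[>] 0) (𝓝 c)) (h : ∀ᶠ ε in 𝓝[>] 0, ∫ s in ε..τ, ‖f s‖ ≤ φ ε) :
    IntegrableOn f (Ioc 0 τ) ∧ ∫ s in 0..τ, ‖f s‖ ≤ c := by
  obtain ⟨u, -, hu_pos, hu⟩ := exists_seq_strictAnti_tendsto_nhdsWithin (0 : ℝ)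
  have hτ_mem : ∀ᶠ ε in 𝓝[>] (0 : ℝ), ε ∈ Ioo 0 τ := Ioo_mem_nhdsGT hτ
  have hintegrable : IntegrableOn f (Ioc 0 τ) := by
    refine integrableOn_Ioc_of_intervalIntegral_norm_bounded_left (I := c + 1)
      (fun n => hf (u n) (hu_pos n)) (tendsto_nhds_of_tendsto_nhdsWithin hu) ?_
    filter_upwards [hu.eventually (hτ_mem.and (h.and (hφ.eventually_lt_const (lt_add_one c))))]
      with n hn
    rw [← intervalIntegral.integral_of_le hn.1.2.le]
    exact hn.2.1.trans hn.2.2.le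
  have hprimitive := intervalIntegral.continuousOn_primitive_interval_left (μ := volume)
    (((integrableOn_Icc_iff_integrableOn_Ioc).2 hintegrable.norm).congr_set_ae
      (Eq.eventuallyEq (uIcc_of_le hτ.le)))
  exact ⟨hintegrable, le_of_tendsto_of_tendsto
    ((hprimitive 0 left_mem_uIcc).mono_of_mem_nhdsWithin (by
      rw [uIcc_of_le hτ.le]; exact Icc_mem_nhdsGT hτ)) hφ h⟩

variable {𝕜 X : Type*} [RCLike 𝕜] [NormedAddCommGroup X] [NormedSpace 𝕜 X]
  {T : ℝ → X →L[𝕜] X} {B : X →ₗ[𝕜] X} {x y : X} {s t ε τ q : ℝ}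

theorem ImmediatelyDifferentiable.exists_mem_generatorGraph (hdiff : ImmediatelyDifferentiable T)
    (hT : IsC0Semigroup T) (hs : 0 < s) (x : X) : ∃ y, (T s x, y) ∈ generatorGraph T := by
  let : NormedSpace ℝ X := NormedSpace.restrictScalars ℝ 𝕜 X
  have : IsScalarTower ℝ 𝕜 X := IsScalarTower.of_algebraMap_smul fun _ _ => rfl
  have hderiv := ((hdiff x).differentiableAt (Ioi_mem_nhds hs)).hasDerivAt
  refine ⟨_, mem_generatorGraph_iff.2
    ((hasDerivWithinAt_Ici_iff_tendsto.1 hderiv.hasDerivWithinAt).congr' ?_)⟩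
  filter_upwards [self_mem_nhdsWithin] with h hh
  rw [add_comm s h, hT.add_apply (le_of_lt hh) hs.le]

namespace IsRelativelyBounded

variable [NormedSpace ℝ X] [IsScalarTower ℝ 𝕜 X]

theorem continuousOn_orbit_Ioi (hB : IsRelativelyBounded T B) (hT : IsC0Semigroup T)
    (hsmooth : ∀ s, 0 < s → ∀ x, ∃ y, (T s x, y) ∈ generatorGraph T) (x : X) :
    ContinuousOn (fun s => B (T s x)) (Ioi 0) := by
  intro s (hs : 0 < s)
  obtain ⟨y, h⟩ := hsmooth (s / 2) (half_pos hs) x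
  exact ((hB.continuousOn_orbit hT h (half_pos hs).le).continuousAt
    (Ici_mem_nhds (half_lt_self hs))).continuousWithinAt

theorem intervalIntegral_norm_orbit_le (hB : IsRelativelyBounded T B) (hT : IsC0Semigroup T)
    (hBA : ∀ x y, (x, y) ∈ generatorGraph T → ∫ s in 0..τ, ‖B (T s x)‖ ≤ q * ‖x‖)
    (h : (T ε x, y) ∈ generatorGraph T) (hε : ε ∈ Icc 0 τ) :
    ∫ s in ε..τ, ‖B (T s x)‖ ≤ q * ‖T ε x‖ := by
  have hcont := (hB.continuousOn_orbit hT h hε.1).norm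
  calc ∫ s in ε..τ, ‖B (T s x)‖ ≤ ∫ s in ε..τ + ε, ‖B (T s x)‖ := by
        refine intervalIntegral.integral_mono_interval le_rfl hε.2 (by linarith [hε.1])
          (ae_of_all _ fun _ => norm_nonneg _) ?_
        exact (hcont.mono fun s hs => (le_min le_rfl (by linarith [hε.1, hε.2])).trans
          hs.1).intervalIntegrable
    _ = ∫ s in 0..τ, ‖B (T (s + ε) x)‖ := by
        rw [intervalIntegral.integral_comp_add_right (fun s => ‖B (T s x)‖), zero_add]
    _ = ∫ s in 0..τ, ‖B (T s (T ε x))‖ := intervalIntegral.integral_congr fun s hs => by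
        rw [uIcc_of_le (hε.1.trans hε.2)] at hs
        simp only [hT.add_apply hs.1 hε.1]
    _ ≤ q * ‖T ε x‖ := hBA _ _ h

theorem isStronglyIntegrableOn (hB : IsRelativelyBounded T B) (hT : IsC0Semigroup T)
    (hsmooth : ∀ s, 0 < s → ∀ x, ∃ y, (T s x, y) ∈ generatorGraph T) (hτ : 0 < τ) (hq : 0 ≤ q)
    (hBA : ∀ x y, (x, y) ∈ generatorGraph T → ∫ s in 0..τ, ‖B (T s x)‖ ≤ q * ‖x‖) :
    IsStronglyIntegrableOn (fun s => B ∘ₗ (T s : X →ₗ[𝕜] X)) τ q := by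
  have hbound : ∀ x, IntegrableOn (fun s => B (T s x)) (Ioc 0 τ) ∧
      ∫ s in 0..τ, ‖B (T s x)‖ ≤ q * ‖x‖ := by
    intro x
    refine integrableOn_Ioc_and_integral_norm_le_of_tendsto hτ (fun ε hε => ?_)
      ((hT.tendsto_orbit_zero x).norm.const_mul q) ?_
    · exact ((hB.continuousOn_orbit_Ioi hT hsmooth x).mono fun s hs =>
        hε.trans_le hs.1).integrableOn_Icc.mono_set Ioc_subset_Icc_self
    · filter_upwards [Ioo_mem_nhdsGT hτ] with ε hε
      obtain ⟨y, h⟩ := hsmooth ε hε.1 x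
      exact hB.intervalIntegral_norm_orbit_le hT hBA h ⟨hε.1.le, hε.2.le⟩
  refine ⟨hq, fun x => (hbound x).1, fun x => ?_⟩
  rw [← intervalIntegral.integral_of_le hτ.le]
  exact (hbound x).2

end IsRelativelyBounded

end Smoothing

section CausalConvolution

variable {Y : Type*} [NormedAddCommGroup Y] {ψ : ℝ → ℝ →ᵇ Y} {τ t : ℝ}

theorem integrableOn_eval_sub (hψ : IntegrableOn ψ (Ioc 0 τ)) (t : ℝ) :
    IntegrableOn (fun s => ψ s (t - s)) (Ioc 0 τ) := by
  refine hψ.norm.mono' ?_ (ae_of_all _ fun s => (ψ s).norm_coe_le_norm _)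
  exact (continuous_eval (F := ℝ →ᵇ Y)).comp_aestronglyMeasurable
    (hψ.aestronglyMeasurable.prodMk (by fun_prop))

theorem continuousAt_indicator_Iio_eval_sub (f : ℝ →ᵇ Y) {s : ℝ} (hst : s ≠ t) :
    ContinuousAt (fun t => (Iio t).indicator (fun s => f (t - s)) s) t := by
  rcases lt_or_gt_of_ne hst with hst | hst
  · refine ContinuousAt.congr (f := fun t => f (t - s)) (by fun_prop) ?_
    filter_upwards [Ioi_mem_nhds hst] with t ht
    rw [indicator_of_mem (mem_Iio.2 ht)]
  · refine continuousAt_const (y := (0 : Y)) |>.congr ?_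
    filter_upwards [Iio_mem_nhds hst] with t ht
    rw [indicator_of_notMem (notMem_Iio.2 (le_of_lt ht))]

variable [NormedSpace ℝ Y]

theorem continuous_integral_indicator_eval_sub (hψ : IntegrableOn ψ (Ioc 0 τ)) :
    Continuous fun t => ∫ s in Ioc 0 τ, (Iio t).indicator (fun s => ψ s (t - s)) s := by
  refine continuous_iff_continuousAt.2 fun t =>
    continuousAt_of_dominated (bound := fun s => ‖ψ s‖) ?_ ?_ hψ.norm ?_
  · exact Eventually.of_forall fun t =>
      (integrableOn_eval_sub hψ t).aestronglyMeasurable.indicator measurableSet_Iio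
  · exact Eventually.of_forall fun _ => ae_of_all _ fun s =>
      (norm_indicator_le_norm_self _ s).trans ((ψ s).norm_coe_le_norm _)
  · filter_upwards [ae_restrict_of_ae (Measure.ae_ne volume t)] with s hs
    exact continuousAt_indicator_Iio_eval_sub (ψ s) hs

/-- The causal convolution `t ↦ ∫ ψ(s)(t - s) ds` over `0 < s < min t τ`, as a bounded continuous
function on the whole line. -/
def causalConv (hψ : IntegrableOn ψ (Ioc 0 τ)) : ℝ →ᵇ Y :=
  BoundedContinuousFunction.ofNormedAddCommGroup
    (fun t => ∫ s in Ioc 0 τ, (Iio t).indicator (fun s => ψ s (t - s)) s)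
    (continuous_integral_indicator_eval_sub hψ) (∫ s in Ioc 0 τ, ‖ψ s‖)
    fun _ => norm_integral_le_of_norm_le hψ.norm (ae_of_all _ fun s =>
      (norm_indicator_le_norm_self _ s).trans ((ψ s).norm_coe_le_norm _))

theorem norm_causalConv_le (hψ : IntegrableOn ψ (Ioc 0 τ)) :
    ‖causalConv hψ‖ ≤ ∫ s in Ioc 0 τ, ‖ψ s‖ :=
  BoundedContinuousFunction.norm_ofNormedAddCommGroup_le _
    (integral_nonneg fun _ => norm_nonneg _) _

theorem causalConv_apply (hψ : IntegrableOn ψ (Ioc 0 τ)) (ht : t ∈ Icc 0 τ) :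
    causalConv hψ t = ∫ s in 0..t, ψ s (t - s) := by
  change ∫ s in Ioc 0 τ, (Iio t).indicator (fun s => ψ s (t - s)) s = _
  have hinter : Ioc 0 τ ∩ Iio t = Ioo 0 t := by
    ext s
    exact ⟨fun hs => ⟨hs.1.1, hs.2⟩, fun hs => ⟨⟨hs.1, hs.2.le.trans ht.2⟩, hs.2⟩⟩
  rw [setIntegral_indicator measurableSet_Iio, hinter, ← integral_Ioc_eq_integral_Ioo,
    intervalIntegral.integral_of_le ht.1]

theorem causalConv_add {φ : ℝ → ℝ →ᵇ Y} (hψ : IntegrableOn ψ (Ioc 0 τ))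
    (hφ : IntegrableOn φ (Ioc 0 τ)) (hψφ : IntegrableOn (fun s => ψ s + φ s) (Ioc 0 τ)) :
    causalConv hψφ = causalConv hψ + causalConv hφ := by
  ext t
  refine Eq.trans ?_ (integral_add ((integrableOn_eval_sub hψ t).indicator measurableSet_Iio)
    ((integrableOn_eval_sub hφ t).indicator measurableSet_Iio))
  simp only [← indicator_add]
  rfl

theorem causalConv_smul {𝕜 : Type*} [RCLike 𝕜] [NormedSpace 𝕜 Y] [SMulCommClass ℝ 𝕜 Y] (c : 𝕜)
    (hψ : IntegrableOn ψ (Ioc 0 τ)) (hcψ : IntegrableOn (fun s => c • ψ s) (Ioc 0 τ)) :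
    causalConv hcψ = c • causalConv hψ := by
  ext t
  refine Eq.trans ?_ (integral_smul c _)
  simp only [← indicator_const_smul]
  rfl

end CausalConvolution

section NeumannSeries

variable {𝕜 E : Type*} [NontriviallyNormedField 𝕜] [NormedAddCommGroup E] [NormedSpace 𝕜 E]
  [CompleteSpace E] {L : E →L[𝕜] E}

theorem summable_pow_apply_of_norm_lt_one (hL : ‖L‖ < 1) (v : E) : Summable fun n => (L ^ n) v :=
  (ContinuousLinearMap.apply 𝕜 E v).summable (summable_geometric_of_norm_lt_one hL)

theorem tsum_pow_apply_eq_add (hL : ‖L‖ < 1) (v : E) :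
    ∑' n, (L ^ n) v = v + L (∑' n, (L ^ n) v) := by
  have hsummable := summable_pow_apply_of_norm_lt_one hL v
  rw [L.map_tsum hsummable, hsummable.tsum_eq_zero_add]
  simp only [pow_zero, pow_succ', mul_apply_eq_comp, one_apply_eq_self]

end NeumannSeries

section Volterra

variable {𝕜 X Y : Type*} [RCLike 𝕜] [NormedAddCommGroup X] [NormedSpace 𝕜 X]
  [NormedAddCommGroup Y] [NormedSpace 𝕜 Y] {F : ℝ → X →ₗ[𝕜] X} {τ q t : ℝ}

namespace IsStronglyIntegrableOn

theorem integrableOn_comp (hF : IsStronglyIntegrableOn F τ q) (W : X →L[𝕜] ℝ →ᵇ Y) (x : X) :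
    IntegrableOn (fun s => W (F s x)) (Ioc 0 τ) :=
  W.integrable_comp (hF.integrableOn x)

theorem intervalIntegrable_eval_sub (hF : IsStronglyIntegrableOn F τ q) (W : X →L[𝕜] ℝ →ᵇ Y)
    (x : X) (t : ℝ) {a b : ℝ} (ha : a ∈ Icc 0 τ) (hb : b ∈ Icc 0 τ) :
    IntervalIntegrable (fun s => W (F s x) (t - s)) volume a b :=
  ((intervalIntegrable_iff_integrableOn_Ioc_of_le (ha.1.trans ha.2)).2
    (integrableOn_eval_sub (hF.integrableOn_comp W x) t)).mono_set (by
      rw [uIcc_of_le (ha.1.trans ha.2)]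
      exact uIcc_subset_Icc ha hb)

theorem integral_norm_comp_le (hF : IsStronglyIntegrableOn F τ q) (W : X →L[𝕜] ℝ →ᵇ Y) (x : X) :
    ∫ s in Ioc 0 τ, ‖W (F s x)‖ ≤ q * ‖W‖ * ‖x‖ :=
  calc ∫ s in Ioc 0 τ, ‖W (F s x)‖ ≤ ∫ s in Ioc 0 τ, ‖W‖ * ‖F s x‖ :=
        integral_mono (hF.integrableOn_comp W x).norm ((hF.integrableOn x).norm.const_mul _)
          fun s => W.le_opNorm _
    _ = ‖W‖ * ∫ s in Ioc 0 τ, ‖F s x‖ := integral_const_mul _ _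
    _ ≤ ‖W‖ * (q * ‖x‖) := by gcongr; exact hF.integral_norm_le x
    _ = q * ‖W‖ * ‖x‖ := by ring

variable [NormedSpace ℝ Y] [IsScalarTower ℝ 𝕜 Y]

/-- The Volterra operator of the variation of parameters formula: it sends `W` to
`t ↦ ∫ W(t - s) F(s) ds` over `0 < s < min t τ`. Operator families are encoded as bounded operators
from `X` into the bounded continuous functions, so that this is a bounded operator on a Banach
space. -/
def volterra (hF : IsStronglyIntegrableOn F τ q) :
    (X →L[𝕜] ℝ →ᵇ Y) →L[𝕜] (X →L[𝕜] ℝ →ᵇ Y) :=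
  LinearMap.mkContinuous₂
    (LinearMap.mk₂ 𝕜 (fun W x => causalConv (hF.integrableOn_comp W x))
      (fun W W' x => causalConv_add (hF.integrableOn_comp W x) (hF.integrableOn_comp W' x) _)
      (fun c W x => causalConv_smul c (hF.integrableOn_comp W x) _)
      (fun W x y => by
        simp only [map_add]
        exact causalConv_add (hF.integrableOn_comp W x) (hF.integrableOn_comp W y) _)
      (fun c W x => by
        simp only [map_smul]
        exact causalConv_smul c (hF.integrableOn_comp W x) _))
    q fun W x =>
      (norm_causalConv_le (hF.integrableOn_comp W x)).trans (hF.integral_norm_comp_le W x)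

theorem norm_volterra_lt_one (hF : IsStronglyIntegrableOn F τ q) (hq : q < 1) :
    ‖hF.volterra (Y := Y)‖ < 1 :=
  (LinearMap.mkContinuous₂_norm_le _ hF.nonneg _).trans_lt hq

theorem volterra_apply (hF : IsStronglyIntegrableOn F τ q) (W : X →L[𝕜] ℝ →ᵇ Y) (x : X)
    (ht : t ∈ Icc 0 τ) : hF.volterra W x t = ∫ s in 0..t, W (F s x) (t - s) :=
  causalConv_apply (hF.integrableOn_comp W x) ht

/-- The Dyson–Phillips series `∑ 𝒱ⁿ G` of the Volterra operator `𝒱`. -/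
def dysonPhillips (hF : IsStronglyIntegrableOn F τ q) (G : X →L[𝕜] ℝ →ᵇ Y) : X →L[𝕜] ℝ →ᵇ Y :=
  ∑' n : ℕ, (hF.volterra ^ n) G

variable [CompleteSpace Y]

theorem hasSum_dysonPhillips_apply (hF : IsStronglyIntegrableOn F τ q) (hq : q < 1)
    (G : X →L[𝕜] ℝ →ᵇ Y) (x : X) (t : ℝ) :
    HasSum (fun n => (hF.volterra ^ n) G x t) (hF.dysonPhillips G x t) := by
  have hsum := (summable_pow_apply_of_norm_lt_one (hF.norm_volterra_lt_one (Y := Y) hq) G).hasSum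
  exact (hsum.mapL (ContinuousLinearMap.apply 𝕜 _ x)).mapL (BoundedContinuousFunction.evalCLM 𝕜 t)

theorem dysonPhillips_apply (hF : IsStronglyIntegrableOn F τ q) (hq : q < 1)
    (G : X →L[𝕜] ℝ →ᵇ Y) (x : X) (ht : t ∈ Icc 0 τ) :
    hF.dysonPhillips G x t = G x t + ∫ s in 0..t, hF.dysonPhillips G (F s x) (t - s) := by
  rw [← hF.volterra_apply _ _ ht]
  exact DFunLike.congr_fun
    (DFunLike.congr_fun (tsum_pow_apply_eq_add (hF.norm_volterra_lt_one (Y := Y) hq) G) x) t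

end IsStronglyIntegrableOn

end Volterra

section PerturbedSemigroup

variable {𝕜 X Y : Type*} [RCLike 𝕜] [NormedAddCommGroup X] [NormedSpace 𝕜 X]
  [NormedAddCommGroup Y] [NormedSpace 𝕜 Y] {F : ℝ → X →ₗ[𝕜] X} {T : ℝ → X →L[𝕜] X}
  {τ q c t : ℝ}

/-- A strongly continuous family on `[0, τ]`, extended to the line by its values at the endpoints
and encoded as a bounded operator into the bounded continuous functions. -/
def orbitMap [CompleteSpace X] (W : ℝ → X →L[𝕜] Y) (hτ : 0 ≤ τ)
    (hW : ∀ x, ContinuousOn (fun t => W t x) (Icc 0 τ)) : X →L[𝕜] ℝ →ᵇ Y :=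
  let hbound := (exists_norm_le_of_continuousOn_orbit isCompact_Icc hW).choose_spec
  LinearMap.mkContinuous
    { toFun := fun x => BoundedContinuousFunction.ofNormedAddCommGroup
        (fun t => W (projIcc 0 τ hτ t) x)
        ((hW x).comp_continuous (by fun_prop) fun t => (projIcc 0 τ hτ t).2) _
        fun t => (W _).le_of_opNorm_le (hbound.2 _ (projIcc 0 τ hτ t).2) x
      map_add' := fun x y => by ext t; exact (W (projIcc 0 τ hτ t)).map_add x y
      map_smul' := fun c x => by ext t; exact (W (projIcc 0 τ hτ t)).map_smul c x }
    _ fun x => BoundedContinuousFunction.norm_ofNormedAddCommGroup_le _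
      (mul_nonneg hbound.1 (norm_nonneg x))
      fun t => (W _).le_of_opNorm_le (hbound.2 _ (projIcc 0 τ hτ t).2) x

theorem orbitMap_apply [CompleteSpace X] (W : ℝ → X →L[𝕜] Y) (hτ : 0 ≤ τ)
    (hW : ∀ x, ContinuousOn (fun t => W t x) (Icc 0 τ)) (x : X) (ht : t ∈ Icc 0 τ) :
    orbitMap W hτ hW x t = W t x := by
  change W (projIcc 0 τ hτ t) x = W t x
  rw [projIcc_of_mem hτ ht]

namespace IsStronglyIntegrableOn

theorem eq_zero_of_volterra_fixed [NormedSpace ℝ Y] (hF : IsStronglyIntegrableOn F τ q)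
    (hq : q < 1) {D : ℝ → X →L[𝕜] Y} (hc : 0 ≤ c) (hD_bound : ∀ t ∈ Icc 0 τ, ‖D t‖ ≤ c)
    (hD : ∀ t ∈ Icc 0 τ, ∀ x, D t x = ∫ s in 0..t, D (t - s) (F s x)) (ht : t ∈ Icc 0 τ) :
    D t = 0 := by
  have hgeometric : ∀ n : ℕ, ∀ t ∈ Icc 0 τ, ‖D t‖ ≤ c * q ^ n := by
    intro n
    induction n with
    | zero => simpa using hD_bound
    | succ n ih =>
      intro t ht
      have hcq : 0 ≤ c * q ^ n := mul_nonneg hc (pow_nonneg hF.nonneg n)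
      refine (D t).opNorm_le_bound (mul_nonneg hc (pow_nonneg hF.nonneg _)) fun x => ?_
      have hF_t := hF.mono ht.2
      calc ‖D t x‖ = ‖∫ s in Ioc 0 t, D (t - s) (F s x)‖ := by
            rw [hD t ht, intervalIntegral.integral_of_le ht.1]
        _ ≤ ∫ s in Ioc 0 t, c * q ^ n * ‖F s x‖ := by
            refine norm_integral_le_of_norm_le ((hF_t.integrableOn x).norm.const_mul _) ?_
            filter_upwards [ae_restrict_mem measurableSet_Ioc] with s hs
            exact (D (t - s)).le_of_opNorm_le
              (ih _ ⟨sub_nonneg.2 hs.2, (sub_le_self t hs.1.le).trans ht.2⟩) _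
        _ = c * q ^ n * ∫ s in Ioc 0 t, ‖F s x‖ := integral_const_mul _ _
        _ ≤ c * q ^ n * (q * ‖x‖) := by gcongr; exact hF_t.integral_norm_le x
        _ = c * q ^ (n + 1) * ‖x‖ := by ring
  have hlim : Tendsto (fun n : ℕ => c * q ^ n) atTop (𝓝 0) := by
    simpa using (tendsto_pow_atTop_nhds_zero_of_lt_one hF.nonneg hq).const_mul c
  exact norm_le_zero_iff.1 (ge_of_tendsto' hlim fun n => hgeometric n t ht)

variable [NormedSpace ℝ X] [IsScalarTower ℝ 𝕜 X] [CompleteSpace X]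

/-- The family `t ↦ U(t)` solving `U(t) = T(t) + ∫ U(t - s) F(s) ds` on `[0, τ]`. For
`F(s) = B T(s)` this is the semigroup obtained by perturbing the generator of `T` by `B`. -/
def perturbation (hF : IsStronglyIntegrableOn F τ q) (hT : IsC0Semigroup T) (hτ : 0 ≤ τ) (t : ℝ) :
    X →L[𝕜] X :=
  BoundedContinuousFunction.evalCLM 𝕜 t ∘L
    hF.dysonPhillips (orbitMap T hτ (hT.isLocalC0Semigroup τ).continuousOn_orbit)

theorem continuous_perturbation (hF : IsStronglyIntegrableOn F τ q) (hT : IsC0Semigroup T)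
    (hτ : 0 ≤ τ) (x : X) : Continuous fun t => hF.perturbation hT hτ t x :=
  (hF.dysonPhillips _ x).continuous

theorem perturbation_apply (hF : IsStronglyIntegrableOn F τ q) (hq : q < 1) (hT : IsC0Semigroup T)
    (hτ : 0 ≤ τ) (ht : t ∈ Icc 0 τ) (x : X) : hF.perturbation hT hτ t x =
      T t x + ∫ s in 0..t, hF.perturbation hT hτ (t - s) (F s x) := by
  refine (hF.dysonPhillips_apply hq _ x ht).trans ?_
  rw [orbitMap_apply T hτ _ x ht]
  rfl

theorem intervalIntegrable_perturbation (hF : IsStronglyIntegrableOn F τ q)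
    (hT : IsC0Semigroup T) (hτ : 0 ≤ τ) (x : X) (t : ℝ) {a b : ℝ} (ha : a ∈ Icc 0 τ)
    (hb : b ∈ Icc 0 τ) :
    IntervalIntegrable (fun s => hF.perturbation hT hτ (t - s) (F s x)) volume a b :=
  hF.intervalIntegrable_eval_sub _ x t ha hb

theorem perturbation_add_sub_mul (hF : IsStronglyIntegrableOn F τ q) (hq : q < 1)
    (hT : IsC0Semigroup T) (hτ : 0 ≤ τ)
    (hFT : ∀ s r, 0 < s → 0 ≤ r → ∀ x, F (s + r) x = F s (T r x)) {r : ℝ} (ht : 0 ≤ t)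
    (hr : 0 ≤ r) (htr : t + r ≤ τ) (x : X) :
    (hF.perturbation hT hτ (t + r) - hF.perturbation hT hτ t * hF.perturbation hT hτ r) x =
      ∫ s in 0..r, (hF.perturbation hT hτ (t + (r - s)) -
        hF.perturbation hT hτ t * hF.perturbation hT hτ (r - s)) (F s x) := by
  set U := hF.perturbation hT hτ
  have ht_mem : t ∈ Icc 0 τ := ⟨ht, by linarith⟩
  have hr_mem : r ∈ Icc 0 τ := ⟨hr, by linarith⟩
  have h0_mem : (0 : ℝ) ∈ Icc 0 τ := ⟨le_rfl, hτ⟩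
  have htr_mem : t + r ∈ Icc 0 τ := ⟨add_nonneg ht hr, htr⟩
  have htail : ∫ s in r..t + r, U (t + r - s) (F s x) = ∫ s in 0..t, U (t - s) (F s (T r x)) := by
    have hsubst := intervalIntegral.integral_comp_add_right (a := 0) (b := t)
      (fun s => U (t + r - s) (F s x)) r
    rw [zero_add] at hsubst
    rw [← hsubst, intervalIntegral.integral_of_le ht, intervalIntegral.integral_of_le ht]
    refine setIntegral_congr_fun measurableSet_Ioc fun s hs => ?_
    simp only [add_sub_add_right_eq_sub, hFT s r hs.1 hr]
  have hproduct : U t (U r x) =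
      U t (T r x) + ∫ s in 0..r, U t (U (r - s) (F s x)) := by
    rw [hF.perturbation_apply hq hT hτ hr_mem x, map_add,
      ← (U t).intervalIntegral_comp_comm
        (hF.intervalIntegrable_perturbation hT hτ x r h0_mem hr_mem)]
  simp only [sub_apply, mul_apply_eq_comp]
  rw [hproduct, hF.perturbation_apply hq hT hτ htr_mem, hF.perturbation_apply hq hT hτ ht_mem,
    hT.add_apply ht hr, ← htail, ← intervalIntegral.integral_add_adjacent_intervals
      (hF.intervalIntegrable_perturbation hT hτ x (t + r) h0_mem hr_mem)
      (hF.intervalIntegrable_perturbation hT hτ x (t + r) hr_mem htr_mem),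
    intervalIntegral.integral_sub]
  · simp only [add_sub_assoc]
    abel
  · simpa only [add_sub_assoc] using
      hF.intervalIntegrable_perturbation hT hτ x (t + r) h0_mem hr_mem
  · have hintegrable := hF.intervalIntegrable_perturbation hT hτ x r h0_mem hr_mem
    exact ⟨(U t).integrable_comp hintegrable.1, (U t).integrable_comp hintegrable.2⟩

theorem isLocalC0Semigroup_perturbation (hF : IsStronglyIntegrableOn F τ q) (hq : q < 1)
    (hT : IsC0Semigroup T) (hτ : 0 ≤ τ)
    (hFT : ∀ s r, 0 < s → 0 ≤ r → ∀ x, F (s + r) x = F s (T r x)) :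
    IsLocalC0Semigroup (hF.perturbation hT hτ) τ where
  map_zero := by
    ext x
    rw [hF.perturbation_apply hq hT hτ ⟨le_rfl, hτ⟩, intervalIntegral.integral_same, add_zero,
      hT.map_zero, ContinuousLinearMap.one_def]
  map_add t r ht hr htr := by
    set U := hF.perturbation hT hτ
    have hcont : ∀ x, ContinuousOn (fun s => (U (t + s) - U t * U s) x) (Icc 0 (τ - t)) := by
      intro x
      have := hF.continuous_perturbation hT hτ x
      refine Continuous.continuousOn ?_
      exact (this.comp (continuous_const.add continuous_id)).sub ((U t).continuous.comp this)
    obtain ⟨c, hc, hbound⟩ := exists_norm_le_of_continuousOn_orbit isCompact_Icc hcont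
    refine sub_eq_zero.1 ((hF.mono (sub_le_self τ ht)).eq_zero_of_volterra_fixed hq
      (D := fun s => U (t + s) - U t * U s) hc hbound (fun s hs x => ?_) ⟨hr, by linarith⟩)
    exact hF.perturbation_add_sub_mul hq hT hτ hFT ht hs.1 (by linarith [hs.2]) x
  continuousOn_orbit x := (hF.continuous_perturbation hT hτ x).continuousOn

end IsStronglyIntegrableOn

end PerturbedSemigroup

section PerturbedGenerator

theorem tendsto_inv_smul_integral {E : Type*} [NormedAddCommGroup E] [NormedSpace ℝ E]
    [CompleteSpace E] {g : ℝ → ℝ → E} {b : E}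
    (hg : ∀ᶠ h in 𝓝[>] 0, IntervalIntegrable (g h) volume 0 h)
    (hgb : ∀ ε, 0 < ε → ∀ᶠ h in 𝓝[>] 0, ∀ s ∈ Ioc 0 h, ‖g h s - b‖ ≤ ε) :
    Tendsto (fun h => h⁻¹ • ∫ s in 0..h, g h s) (𝓝[>] 0) (𝓝 b) := by
  refine Metric.tendsto_nhds.2 fun ε hε => ?_
  filter_upwards [hg, hgb (ε / 2) (half_pos hε), self_mem_nhdsWithin] with h hgh hgbh (hh : 0 < h)
  have hcentered : h⁻¹ • (∫ s in 0..h, g h s) - b = h⁻¹ • ∫ s in 0..h, (g h s - b) := by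
    rw [intervalIntegral.integral_sub hgh intervalIntegrable_const,
      intervalIntegral.integral_const, sub_zero, smul_sub, inv_smul_smul₀ hh.ne']
  have hbound : ‖∫ s in 0..h, (g h s - b)‖ ≤ ε / 2 * h := by
    simpa [abs_of_pos hh] using intervalIntegral.norm_integral_le_of_norm_le_const
      fun s hs => hgbh s (uIoc_of_le hh.le ▸ hs)
  rw [dist_eq_norm, hcentered, norm_smul, norm_inv, Real.norm_of_nonneg hh.le]
  calc h⁻¹ * ‖∫ s in 0..h, (g h s - b)‖ ≤ h⁻¹ * (ε / 2 * h) := by gcongr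
    _ = ε / 2 := by field_simp
    _ < ε := half_lt_self hε

variable {𝕜 X : Type*} [RCLike 𝕜] [NormedAddCommGroup X] [NormedSpace 𝕜 X]
  {T S : ℝ → X →L[𝕜] X} {B : X →ₗ[𝕜] X} {x y : X} {τ q μ : ℝ}

theorem eventually_norm_apply_sub_le [CompleteSpace X] {U : ℝ → X →L[𝕜] X}
    (hU : ∀ x, ContinuousOn (fun t => U t x) (Icc 0 τ)) (hτ : 0 < τ) {f : ℝ → X}
    (hf : Tendsto f (𝓝[>] 0) (𝓝 y)) {ε : ℝ} (hε : 0 < ε) :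
    ∀ᶠ h in 𝓝[>] 0, ∀ s ∈ Ioc 0 h, ‖U (h - s) (f s) - U 0 y‖ ≤ ε := by
  have hjoint : Tendsto (fun p : ℝ × ℝ => U p.1 (f p.2)) (𝓝[≥] 0 ×ˢ 𝓝[>] 0) (𝓝 (U 0 y)) := by
    have hcont := (continuousOn_uncurry_of_continuousOn_orbit isCompact_Icc hU) (0, y)
      ⟨left_mem_Icc.2 hτ.le, mem_univ y⟩
    rw [ContinuousWithinAt, nhdsWithin_prod_eq, nhdsWithin_univ, nhdsWithin_Icc_eq_nhdsGE hτ]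
      at hcont
    exact hcont.comp (tendsto_id.prodMap hf)
  obtain ⟨P, hP, Q, hQ, hPQ⟩ := eventually_prod_iff.1 (Metric.tendsto_nhds.1 hjoint ε hε)
  obtain ⟨a, ha, hPa⟩ := mem_nhdsGE_iff_exists_Ico_subset.1 hP
  obtain ⟨b, hb, hQb⟩ := mem_nhdsGT_iff_exists_Ioo_subset.1 hQ
  filter_upwards [Ioo_mem_nhdsGT (lt_min ha hb)] with h hh s hs
  have hP_h : P (h - s) := hPa ⟨sub_nonneg.2 hs.2,
    (sub_lt_self h hs.1).trans (hh.2.trans_le (min_le_left a b))⟩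
  have hQ_s : Q s := hQb ⟨hs.1, hs.2.trans_lt (hh.2.trans_le (min_le_right a b))⟩
  rw [← dist_eq_norm]
  exact (hPQ hP_h hQ_s).le

variable [NormedSpace ℝ X] [IsScalarTower ℝ 𝕜 X]

theorem IsC0Semigroup.eq_zero_of_mem_generatorGraph_zero [CompleteSpace X] (hT : IsC0Semigroup T)
    (h : (x, 0) ∈ generatorGraph T) (hτ : 0 ≤ τ) (hT_lt : ‖T τ‖ < 1) : x = 0 := by
  have hfixed : T τ x = x := sub_eq_zero.1 <| by
    simpa using (hT.integral_orbit_eq_sub h hτ).symm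
  by_contra hx
  refine lt_irrefl ‖x‖ ?_
  calc ‖x‖ = ‖T τ x‖ := by rw [hfixed]
    _ ≤ ‖T τ‖ * ‖x‖ := (T τ).le_opNorm x
    _ < ‖x‖ := mul_lt_of_lt_one_left (norm_pos_iff.2 hx) hT_lt

theorem IsStronglyIntegrableOn.comp_rescale
    (hBT : IsStronglyIntegrableOn (fun s => B ∘ₗ (T s : X →ₗ[𝕜] X)) τ q) (hμ : 0 ≤ μ) :
    IsStronglyIntegrableOn (fun s => B ∘ₗ (rescale μ T s : X →ₗ[𝕜] X)) τ q := by
  have heq : ∀ s x, B (rescale μ T s x) = Real.exp (-μ * s) • B (T s x) := fun s x => by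
    rw [RCLike.real_smul_eq_coe_smul (K := 𝕜), ← map_smul]
    rfl
  have hle : ∀ x, ∀ s ∈ Ioc 0 τ, ‖B (rescale μ T s x)‖ ≤ ‖B (T s x)‖ := fun x s hs => by
    rw [heq, norm_smul, Real.norm_of_nonneg (Real.exp_pos _).le]
    exact mul_le_of_le_one_left (norm_nonneg _)
      (Real.exp_le_one_iff.2 (by nlinarith [mul_nonneg hμ hs.1.le]))
  have hintegrable : ∀ x, IntegrableOn (fun s => B (rescale μ T s x)) (Ioc 0 τ) := fun x => by
    refine Integrable.mono (hBT.integrableOn x) ?_ ((ae_restrict_iff' measurableSet_Ioc).2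
      (ae_of_all _ (hle x)))
    simp only [heq]
    exact (Continuous.aestronglyMeasurable (by fun_prop)).smul (hBT.integrableOn x).1
  refine ⟨hBT.nonneg, hintegrable, fun x => ?_⟩
  exact (setIntegral_mono_on (hintegrable x).norm (hBT.integrableOn x).norm measurableSet_Ioc
    (hle x)).trans (hBT.integral_norm_le x)

variable [CompleteSpace X]

namespace IsRelativelyBounded

theorem exists_mem_generatorGraph_add_eq (hB : IsRelativelyBounded T B) (hT : IsC0Semigroup T)
    (hBT : IsStronglyIntegrableOn (fun s => B ∘ₗ (T s : X →ₗ[𝕜] X)) τ q) (hτ : 0 ≤ τ)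
    (hT_lt : ‖T τ‖ < 1 - q) (y : X) : ∃ z a, (z, a) ∈ generatorGraph T ∧ a + B z = y := by
  have hunit : IsUnit (1 - (T τ + hBT.integralCLM)) := isUnit_one_sub_of_norm_lt_one <|
    (norm_add_le _ _).trans_lt (by linarith [hBT.norm_integralCLM_le])
  obtain ⟨w, hw⟩ : ∃ w, (1 - (T τ + hBT.integralCLM)) w = -y := by
    obtain ⟨u, hu⟩ := hunit
    exact ⟨(↑u⁻¹ : X →L[𝕜] X) (-y), by
      rw [← hu, ← mul_apply_eq_comp, Units.mul_inv, one_apply_eq_self]⟩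
  refine ⟨_, _, hT.integral_mem_generatorGraph w hτ, ?_⟩
  rw [hB.map_integral_orbit_of_isStronglyIntegrableOn hT hBT hτ w, ← neg_eq_iff_eq_neg.2 hw]
  simp only [sub_apply, add_apply, one_apply_eq_self]
  abel

theorem mem_generatorGraph_of_perturbation (hB : IsRelativelyBounded T B) (hT : IsC0Semigroup T)
    (hBT : IsStronglyIntegrableOn (fun s => B ∘ₗ (T s : X →ₗ[𝕜] X)) τ q) (hq : q < 1) (hτ : 0 < τ)
    (hSU : EqOn S (hBT.perturbation hT hτ.le) (Icc 0 τ)) (h : (x, y) ∈ generatorGraph T) :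
    (x, y + B x) ∈ generatorGraph S := by
  set U := hBT.perturbation hT hτ.le
  have hτ_mem : ∀ᶠ t in 𝓝[>] (0 : ℝ), t ∈ Icc 0 τ := Icc_mem_nhdsGT hτ
  have hU_zero : U 0 = 1 := by
    ext z
    rw [hBT.perturbation_apply hq hT hτ.le (left_mem_Icc.2 hτ.le), intervalIntegral.integral_same,
      add_zero, hT.zero_apply, one_apply_eq_self]
  have hduhamel : Tendsto (fun t => t⁻¹ • ∫ s in 0..t, U (t - s) (B (T s x))) (𝓝[>] 0)
      (𝓝 (B x)) := by
    refine tendsto_inv_smul_integral ?_ fun ε hε => ?_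
    · filter_upwards [hτ_mem] with t ht
      exact hBT.intervalIntegrable_perturbation hT hτ.le x t (left_mem_Icc.2 hτ.le) ht
    · simpa only [hU_zero, one_apply_eq_self] using eventually_norm_apply_sub_le
        (U := U) (fun z => (hBT.continuous_perturbation hT hτ.le z).continuousOn) hτ
        (hB.tendsto_orbit hT h) hε
  refine mem_generatorGraph_iff.2 (((mem_generatorGraph_iff.1 h).add hduhamel).congr' ?_)
  filter_upwards [hτ_mem] with t ht
  rw [hSU ht, hBT.perturbation_apply hq hT hτ.le ht, ← smul_add, sub_add_eq_add_sub]
  rfl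

/-- The inclusion `A + B ⊆ G` of generators is an equality because, after rescaling both semigroups,
`A + B` is surjective and `G` is injective. -/
theorem mem_generatorGraph_perturbation_iff (hB : IsRelativelyBounded T B) (hT : IsC0Semigroup T)
    (hBT : IsStronglyIntegrableOn (fun s => B ∘ₗ (T s : X →ₗ[𝕜] X)) τ q) (hq : q < 1) (hτ : 0 < τ)
    (hS : IsC0Semigroup S) (hSU : EqOn S (hBT.perturbation hT hτ.le) (Icc 0 τ)) :
    (x, y) ∈ generatorGraph S ↔ (x, y - B x) ∈ generatorGraph T := by
  have hTS : ∀ {x y}, (x, y) ∈ generatorGraph T → (x, y + B x) ∈ generatorGraph S :=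
    hB.mem_generatorGraph_of_perturbation hT hBT hq hτ hSU
  refine ⟨fun h => ?_, fun h => by simpa only [sub_add_cancel] using hTS h⟩
  obtain ⟨μ₁, hμ₁⟩ := exists_norm_rescale_lt T hτ (sub_pos.2 hq)
  obtain ⟨μ₂, hμ₂⟩ := exists_norm_rescale_lt S hτ one_pos
  obtain ⟨μ, hμ, hμμ₁, hμμ₂⟩ : ∃ μ, 0 ≤ μ ∧ μ₁ ≤ μ ∧ μ₂ ≤ μ :=
    ⟨max 0 (max μ₁ μ₂), by simp, by simp, by simp⟩
  obtain ⟨z, a, hza, hz⟩ := (hB.rescale μ).exists_mem_generatorGraph_add_eq (hT.rescale μ)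
    (hBT.comp_rescale hμ) hτ.le (hμ₁ μ hμμ₁) (y - (μ : 𝕜) • x)
  have hza_T : (z, a + (μ : 𝕜) • z) ∈ generatorGraph T := mem_generatorGraph_rescale_iff.1 hza
  have hdiff : (x - z, (0 : X)) ∈ generatorGraph (rescale μ S) := by
    rw [mem_generatorGraph_rescale_iff]
    convert sub_mem h (hTS hza_T) using 1
    rw [Prod.mk_sub_mk, eq_sub_of_add_eq hz, smul_sub]
    congr 1
    abel
  obtain rfl : x = z := sub_eq_zero.1 <|
    (hS.rescale μ).eq_zero_of_mem_generatorGraph_zero hdiff hτ.le (hμ₂ μ hμμ₂)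
  rwa [eq_sub_of_add_eq hz, sub_right_comm, sub_add_cancel] at hza_T

theorem exists_perturbed_semigroup (hB : IsRelativelyBounded T B) (hT : IsC0Semigroup T)
    (hBT : IsStronglyIntegrableOn (fun s => B ∘ₗ (T s : X →ₗ[𝕜] X)) τ q) (hq : q < 1)
    (hτ : 0 < τ) : ∃ S, IsC0Semigroup S ∧ EqOn S (hBT.perturbation hT hτ.le) (Icc 0 τ) ∧
      ∀ x y, (x, y) ∈ generatorGraph S ↔ (x, y - B x) ∈ generatorGraph T := by
  have hU := hBT.isLocalC0Semigroup_perturbation hq hT hτ.le fun s r hs hr x => by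
    rw [LinearMap.comp_apply, ContinuousLinearMap.coe_coe, hT.add_apply hs.le hr]
    rfl
  obtain ⟨S, hS, hSU⟩ := hU.exists_extension hτ
  exact ⟨S, hS, hSU, fun x y => hB.mem_generatorGraph_perturbation_iff hT hBT hq hτ hS hSU⟩

end IsRelativelyBounded

end PerturbedGenerator

section IntegrableMajorant

variable {κ : ℝ → ℝ} {τ ρ : ℝ}

/-- `κ` is nonnegative on `(0, τ]` with integral at most `ρ`; such functions bound the operators
`F(s)` on `V`. -/
structure IsIntegrableMajorantOn (κ : ℝ → ℝ) (τ ρ : ℝ) : Prop where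
  nonneg : ∀ s ∈ Ioc 0 τ, 0 ≤ κ s
  integrableOn : IntegrableOn κ (Ioc 0 τ)
  integral_le : ∫ s in Ioc 0 τ, κ s ≤ ρ

theorem IsIntegrableMajorantOn.bound_nonneg (hκ : IsIntegrableMajorantOn κ τ ρ) : 0 ≤ ρ :=
  (setIntegral_nonneg measurableSet_Ioc hκ.nonneg).trans hκ.integral_le

theorem IsIntegrableMajorantOn.setIntegral_le (hκ : IsIntegrableMajorantOn κ τ ρ) {I : Set ℝ}
    (hI : I ⊆ Ioc 0 τ) : ∫ s in I, κ s ≤ ρ :=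
  (setIntegral_mono_set hκ.integrableOn ((ae_restrict_iff' measurableSet_Ioc).2
    (ae_of_all _ hκ.nonneg)) hI.eventuallyLE).trans hκ.integral_le

theorem exists_isIntegrableMajorantOn_rpow {C β τ₀ : ℝ} (hC : 0 ≤ C) (hβ : β < 1) (hρ : 0 < ρ)
    (hτ₀ : 0 < τ₀) : ∃ τ ∈ Ioc 0 τ₀, IsIntegrableMajorantOn (fun s => C * s ^ (-β)) τ ρ := by
  have hintegrable : IntervalIntegrable (fun s => C * s ^ (-β)) volume 0 τ₀ :=
    (intervalIntegral.intervalIntegrable_rpow' (by linarith)).const_mul C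
  have hprimitive := intervalIntegral.continuousOn_primitive_interval' hintegrable left_mem_uIcc
  have hlim : Tendsto (fun τ => ∫ s in 0..τ, C * s ^ (-β)) (𝓝[>] 0) (𝓝 0) := by
    have := hprimitive 0 left_mem_uIcc
    rw [ContinuousWithinAt, intervalIntegral.integral_same, uIcc_of_le hτ₀.le,
      nhdsWithin_Icc_eq_nhdsGE hτ₀] at this
    exact this.mono_left (nhdsWithin_mono _ Ioi_subset_Ici_self)
  obtain ⟨τ, hτρ, hτ⟩ := ((hlim.eventually_le_const hρ).and (Ioc_mem_nhdsGT hτ₀)).exists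
  refine ⟨τ, hτ, fun s hs => mul_nonneg hC (Real.rpow_nonneg hs.1.le _), ?_, ?_⟩
  · exact hintegrable.1.mono_set (Ioc_subset_Ioc_right hτ.2)
  · rwa [← intervalIntegral.integral_of_le hτ.1.le]

end IntegrableMajorant

section DysonPhillipsRegularity

variable {𝕜 X V : Type*} [RCLike 𝕜] [NormedAddCommGroup X] [NormedSpace 𝕜 X] [NormedSpace ℝ X]
  [IsScalarTower ℝ 𝕜 X] [NormedAddCommGroup V] [NormedSpace 𝕜 V] {ι : V →L[𝕜] X}
  {F : ℝ → X →ₗ[𝕜] X} {G W : X →L[𝕜] ℝ →ᵇ X} {κ : ℝ → ℝ} {τ q ρ α δ θ c C D E t : ℝ}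

variable [CompleteSpace X] [CompleteSpace V]

theorem intervalIntegral_mem_imageBall (hι : Function.Injective ι)
    (hV : TopologicalSpace.SeparableSpace V ∨ IsClosed (imageBall ι 1)) {f : ℝ → X} {φ : ℝ → ℝ}
    {a b r : ℝ} (hab : a ≤ b) (hf : IntervalIntegrable f volume a b)
    (hφ : IntegrableOn φ (Ioc a b)) (h : ∀ s ∈ Ioc a b, f s ∈ imageBall ι (φ s))
    (hr : ∫ s in Ioc a b, φ s ≤ r) : ∫ s in a..b, f s ∈ imageBall ι r := by
  rw [intervalIntegral.integral_of_le hab]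
  exact imageBall_mono hr <| integral_mem_imageBall hι hV hf.1 hφ <|
    (ae_restrict_iff' measurableSet_Ioc).2 (ae_of_all _ h)

namespace IsStronglyIntegrableOn

theorem volterra_pow_mem_imageBall (hF : IsStronglyIntegrableOn F τ q)
    (hι : Function.Injective ι)
    (hV : TopologicalSpace.SeparableSpace V ∨ IsClosed (imageBall ι 1))
    (hκ : IsIntegrableMajorantOn κ τ ρ)
    (hFV : ∀ s ∈ Ioc 0 τ, ∀ v, F s (ι v) ∈ imageBall ι (κ s * ‖v‖))
    (hC : 0 ≤ C) (hGV : ∀ t ∈ Icc 0 τ, ∀ v, G (ι v) t ∈ imageBall ι (C * ‖v‖)) (n : ℕ)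
    (ht : t ∈ Icc 0 τ) (v : V) :
    (hF.volterra ^ n) G (ι v) t ∈ imageBall ι (C * ρ ^ n * ‖v‖) := by
  have hρ : 0 ≤ ρ := hκ.bound_nonneg
  induction n generalizing t v with
  | zero => simpa using hGV t ht v
  | succ n ih =>
    have hsubset : Ioc 0 t ⊆ Ioc 0 τ := Ioc_subset_Ioc_right ht.2
    rw [pow_succ' hF.volterra, mul_apply_eq_comp, hF.volterra_apply _ _ ht]
    refine intervalIntegral_mem_imageBall hι hV ht.1
      (hF.intervalIntegrable_eval_sub _ _ t (left_mem_Icc.2 (ht.1.trans ht.2)) ht)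
      (((hκ.integrableOn.mono_set hsubset).mul_const ‖v‖).const_mul (C * ρ ^ n)) (fun s hs => ?_) ?_
    · exact map_mem_imageBall (L := fun y => (hF.volterra ^ n) G y (t - s))
        (ih ⟨sub_nonneg.2 hs.2, (sub_le_self t hs.1.le).trans ht.2⟩)
        (by positivity) (hFV s (hsubset hs) v)
    · rw [integral_const_mul, integral_mul_const]
      calc C * ρ ^ n * ((∫ s in Ioc 0 t, κ s) * ‖v‖) ≤ C * ρ ^ n * (ρ * ‖v‖) := by
            gcongr; exact hκ.setIntegral_le hsubset
        _ = C * ρ ^ (n + 1) * ‖v‖ := by ring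

theorem intervalIntegral_near_zero_mem_imageBall (hF : IsStronglyIntegrableOn F τ q)
    (hι : Function.Injective ι)
    (hV : TopologicalSpace.SeparableSpace V ∨ IsClosed (imageBall ι 1)) (hα : 0 ≤ α)
    (hδ : δ ∈ Ioo (0 : ℝ) 1) (hE : 0 ≤ E)
    (hW : ∀ t ∈ Ioc 0 τ, ∀ x, W x t ∈ imageBall ι (E * t ^ (-α) * ‖x‖)) (ht : t ∈ Ioc 0 τ) (x : X) :
    ∫ s in 0..δ * t, W (F s x) (t - s) ∈
      imageBall ι (q * (1 - δ) ^ (-α) * E * t ^ (-α) * ‖x‖) := by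
  have hδ_compl : 0 < 1 - δ := sub_pos.2 hδ.2
  have hδt : 0 ≤ δ * t := mul_nonneg hδ.1.le ht.1.le
  have hδtτ : δ * t ≤ τ := (mul_le_of_le_one_left ht.1.le hδ.2.le).trans ht.2
  refine intervalIntegral_mem_imageBall hι hV hδt
    (hF.intervalIntegrable_eval_sub W x t ⟨le_rfl, hδt.trans hδtτ⟩ ⟨hδt, hδtτ⟩)
    (((hF.mono hδtτ).integrableOn x).norm.const_mul (E * ((1 - δ) * t) ^ (-α))) (fun s hs => ?_) ?_
  · have hts : (1 - δ) * t ≤ t - s := by linarith [hs.2]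
    have hts_pos : 0 < (1 - δ) * t := mul_pos hδ_compl ht.1
    refine imageBall_mono ?_ (hW (t - s) ⟨hts_pos.trans_le hts, by linarith [hs.1, ht.2]⟩ (F s x))
    gcongr _ * ?_ * _
    exact Real.rpow_le_rpow_of_nonpos hts_pos hts (neg_nonpos.2 hα)
  · have := Real.rpow_nonneg hδ_compl.le (-α)
    have := Real.rpow_nonneg ht.1.le (-α)
    rw [integral_const_mul, Real.mul_rpow hδ_compl.le ht.1.le]
    calc E * ((1 - δ) ^ (-α) * t ^ (-α)) * ∫ s in Ioc 0 (δ * t), ‖F s x‖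
        ≤ E * ((1 - δ) ^ (-α) * t ^ (-α)) * (q * ‖x‖) := by
          gcongr; exact (hF.mono hδtτ).integral_norm_le x
      _ = _ := by ring

theorem intervalIntegral_away_zero_mem_imageBall (hF : IsStronglyIntegrableOn F τ q)
    (hι : Function.Injective ι)
    (hV : TopologicalSpace.SeparableSpace V ∨ IsClosed (imageBall ι 1))
    (hκ : IsIntegrableMajorantOn κ τ ρ) (hα : 0 ≤ α) (hD : 0 ≤ D)
    (hFX : ∀ s ∈ Ioc 0 τ, ∀ x, F s x ∈ imageBall ι (κ s * (D * s ^ (-α) * ‖x‖)))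
    (hδ : δ ∈ Ioo (0 : ℝ) 1) (hc : 0 ≤ c)
    (hW : ∀ t ∈ Icc 0 τ, ∀ v, W (ι v) t ∈ imageBall ι (c * ‖v‖)) (ht : t ∈ Ioc 0 τ) (x : X) :
    ∫ s in δ * t..t, W (F s x) (t - s) ∈
      imageBall ι (c * ρ * D * δ ^ (-α) * t ^ (-α) * ‖x‖) := by
  have hδt : 0 < δ * t := mul_pos hδ.1 ht.1
  have hδt_le : δ * t ≤ t := mul_le_of_le_one_left ht.1.le hδ.2.le
  have hsubset : Ioc (δ * t) t ⊆ Ioc 0 τ := Ioc_subset_Ioc hδt.le ht.2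
  refine intervalIntegral_mem_imageBall hι hV hδt_le
    (hF.intervalIntegrable_eval_sub W x t ⟨hδt.le, hδt_le.trans ht.2⟩ ⟨ht.1.le, ht.2⟩)
    (((hκ.integrableOn.mono_set hsubset).mul_const (D * (δ * t) ^ (-α) * ‖x‖)).const_mul c)
    (fun s hs => ?_) ?_
  · have hs_mem := hsubset hs
    refine map_mem_imageBall (L := fun y => W y (t - s))
      (hW (t - s) ⟨sub_nonneg.2 hs.2, by linarith [hs_mem.1, ht.2]⟩) hc
      (imageBall_mono ?_ (hFX s hs_mem x))
    have := hκ.nonneg s hs_mem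
    gcongr _ * (_ * ?_ * _)
    exact Real.rpow_le_rpow_of_nonpos hδt hs.1.le (neg_nonpos.2 hα)
  · have := Real.rpow_nonneg hδ.1.le (-α)
    have := Real.rpow_nonneg ht.1.le (-α)
    rw [integral_const_mul, integral_mul_const, Real.mul_rpow hδ.1.le ht.1.le]
    calc c * ((∫ s in Ioc (δ * t) t, κ s) * (D * (δ ^ (-α) * t ^ (-α)) * ‖x‖))
        ≤ c * (ρ * (D * (δ ^ (-α) * t ^ (-α)) * ‖x‖)) := by
          gcongr; exact hκ.setIntegral_le hsubset
      _ = _ := by ring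

theorem volterra_apply_mem_imageBall (hF : IsStronglyIntegrableOn F τ q)
    (hι : Function.Injective ι)
    (hV : TopologicalSpace.SeparableSpace V ∨ IsClosed (imageBall ι 1))
    (hκ : IsIntegrableMajorantOn κ τ ρ) (hα : 0 ≤ α) (hD : 0 ≤ D)
    (hFX : ∀ s ∈ Ioc 0 τ, ∀ x, F s x ∈ imageBall ι (κ s * (D * s ^ (-α) * ‖x‖)))
    (hδ : δ ∈ Ioo (0 : ℝ) 1) (hc : 0 ≤ c) (hE : 0 ≤ E)
    (hWV : ∀ t ∈ Icc 0 τ, ∀ v, W (ι v) t ∈ imageBall ι (c * ‖v‖))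
    (hWX : ∀ t ∈ Ioc 0 τ, ∀ x, W x t ∈ imageBall ι (E * t ^ (-α) * ‖x‖)) (ht : t ∈ Ioc 0 τ)
    (x : X) : hF.volterra W x t ∈
      imageBall ι ((q * (1 - δ) ^ (-α) * E + c * ρ * D * δ ^ (-α)) * t ^ (-α) * ‖x‖) := by
  have h0_mem : (0 : ℝ) ∈ Icc 0 τ := ⟨le_rfl, ht.1.le.trans ht.2⟩
  have ht_mem : t ∈ Icc 0 τ := ⟨ht.1.le, ht.2⟩
  have hδt_mem : δ * t ∈ Icc 0 τ := ⟨mul_nonneg hδ.1.le ht.1.le,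
    (mul_le_of_le_one_left ht.1.le hδ.2.le).trans ht.2⟩
  rw [hF.volterra_apply W x ht_mem, ← intervalIntegral.integral_add_adjacent_intervals
    (hF.intervalIntegrable_eval_sub W x t h0_mem hδt_mem)
    (hF.intervalIntegrable_eval_sub W x t hδt_mem ht_mem), add_mul, add_mul]
  exact add_mem_imageBall
    (hF.intervalIntegral_near_zero_mem_imageBall hι hV hα hδ hE hWX ht x)
    (hF.intervalIntegral_away_zero_mem_imageBall hι hV hκ hα hD hFX hδ hc hWV ht x)

/-- The constants satisfy a recursion with ratios `q (1 - δ)^(-α)` and `ρ`; bounding both by `θ`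
gives it the resonant solution `(C + n C D δ^(-α)) θⁿ`. -/
theorem volterra_pow_apply_mem_imageBall (hF : IsStronglyIntegrableOn F τ q)
    (hι : Function.Injective ι)
    (hV : TopologicalSpace.SeparableSpace V ∨ IsClosed (imageBall ι 1))
    (hκ : IsIntegrableMajorantOn κ τ ρ) (hα : 0 ≤ α) (hD : 0 ≤ D)
    (hFV : ∀ s ∈ Ioc 0 τ, ∀ v, F s (ι v) ∈ imageBall ι (κ s * ‖v‖))
    (hFX : ∀ s ∈ Ioc 0 τ, ∀ x, F s x ∈ imageBall ι (κ s * (D * s ^ (-α) * ‖x‖)))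
    (hC : 0 ≤ C) (hGV : ∀ t ∈ Icc 0 τ, ∀ v, G (ι v) t ∈ imageBall ι (C * ‖v‖))
    (hGX : ∀ t ∈ Ioc 0 τ, ∀ x, G x t ∈ imageBall ι (C * t ^ (-α) * ‖x‖))
    (hδ : δ ∈ Ioo (0 : ℝ) 1) (hqθ : q * (1 - δ) ^ (-α) ≤ θ) (hρθ : ρ ≤ θ) (n : ℕ)
    (ht : t ∈ Ioc 0 τ) (x : X) : (hF.volterra ^ n) G x t ∈
      imageBall ι ((C + n * (C * D * δ ^ (-α))) * θ ^ n * t ^ (-α) * ‖x‖) := by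
  have hδα : 0 ≤ δ ^ (-α) := Real.rpow_nonneg hδ.1.le _
  have hρ : 0 ≤ ρ := hκ.bound_nonneg
  have hθ : 0 ≤ θ := hρ.trans hρθ
  induction n generalizing t x with
  | zero => simpa using hGX t ht x
  | succ n ih =>
    rw [pow_succ' hF.volterra, mul_apply_eq_comp]
    refine imageBall_mono ?_ (hF.volterra_apply_mem_imageBall hι hV hκ hα hD hFX hδ
      (c := C * ρ ^ n) (by positivity) (by positivity)
      (fun t ht v => hF.volterra_pow_mem_imageBall hι hV hκ hFV hC hGV n ht v)
      (fun t ht x => ih ht x) ht x)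
    have := Real.rpow_nonneg ht.1.le (-α)
    gcongr
    calc q * (1 - δ) ^ (-α) * ((C + n * (C * D * δ ^ (-α))) * θ ^ n) +
          C * ρ ^ n * ρ * D * δ ^ (-α)
        ≤ θ * ((C + n * (C * D * δ ^ (-α))) * θ ^ n) + C * θ ^ n * θ * D * δ ^ (-α) := by gcongr
      _ = (C + (n + 1 : ℕ) * (C * D * δ ^ (-α))) * θ ^ (n + 1) := by push_cast; ring

theorem exists_dysonPhillips_mem_imageBall (hF : IsStronglyIntegrableOn F τ q) (hq : q < 1)
    (hι : Function.Injective ι)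
    (hV : TopologicalSpace.SeparableSpace V ∨ IsClosed (imageBall ι 1))
    (hκ : IsIntegrableMajorantOn κ τ ρ) (hρ : ρ < 1) (hα : 0 ≤ α) (hD : 0 ≤ D)
    (hFV : ∀ s ∈ Ioc 0 τ, ∀ v, F s (ι v) ∈ imageBall ι (κ s * ‖v‖))
    (hFX : ∀ s ∈ Ioc 0 τ, ∀ x, F s x ∈ imageBall ι (κ s * (D * s ^ (-α) * ‖x‖)))
    (hC : 0 ≤ C) (hGV : ∀ t ∈ Icc 0 τ, ∀ v, G (ι v) t ∈ imageBall ι (C * ‖v‖))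
    (hGX : ∀ t ∈ Ioc 0 τ, ∀ x, G x t ∈ imageBall ι (C * t ^ (-α) * ‖x‖)) :
    ∃ C', ∀ t ∈ Ioc 0 τ, ∀ x, hF.dysonPhillips G x t ∈ imageBall ι (C' * t ^ (-α) * ‖x‖) := by
  obtain ⟨δ, hδq, hδ⟩ : ∃ δ, q * (1 - δ) ^ (-α) < 1 ∧ δ ∈ Ioo (0 : ℝ) 1 := by
    have hcont : ContinuousAt (fun δ : ℝ => q * (1 - δ) ^ (-α)) 0 :=
      continuousAt_const.mul (ContinuousAt.rpow_const (by fun_prop) (Or.inl (by simp)))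
    exact (((hcont.eventually_lt_const (by simpa using hq)).filter_mono
      nhdsWithin_le_nhds).and (Ioo_mem_nhdsGT one_pos)).exists
  set θ := max (q * (1 - δ) ^ (-α)) ρ
  have hθ_norm : ‖θ‖ < 1 := by
    rw [Real.norm_of_nonneg (hκ.bound_nonneg.trans (le_max_right _ _))]
    exact max_lt hδq hρ
  have hsum : Summable fun n : ℕ => (C + n * (C * D * δ ^ (-α))) * θ ^ n := by
    refine (((summable_geometric_of_norm_lt_one hθ_norm).mul_left C).add
      ((summable_pow_mul_geometric_of_norm_lt_one 1 hθ_norm).mul_left (C * D * δ ^ (-α)))).congr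
      fun n => ?_
    rw [pow_one]
    ring
  refine ⟨_, fun t ht x => hasSum_mem_imageBall (fun n => ?_)
    ((hsum.hasSum.mul_right (t ^ (-α))).mul_right ‖x‖) (hF.hasSum_dysonPhillips_apply hq G x t)⟩
  exact hF.volterra_pow_apply_mem_imageBall hι hV hκ hα hD hFV hFX hC hGV hGX hδ
    (le_max_left _ _) (le_max_right _ _) n ht x

end IsStronglyIntegrableOn

end DysonPhillipsRegularity

section Embedding

variable {𝕜 X V : Type*} [RCLike 𝕜] [NormedAddCommGroup X] [NormedSpace 𝕜 X]
  [NormedAddCommGroup V] [NormedSpace 𝕜 V] {ι : V →L[𝕜] X} {T : ℝ → X →L[𝕜] X}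
  {B : X →ₗ[𝕜] X} {τ q ρ α β c C r s : ℝ}

namespace IsC0Semigroup

theorem apply_orbit_mem_imageBall (hT : IsC0Semigroup T) (hC : 0 ≤ C)
    (hTX : ∀ t ∈ Ioc 0 τ, ∀ x, T t x ∈ imageBall ι (C * t ^ (-α) * ‖x‖))
    (hBV : ∀ t ∈ Ioc 0 τ, ∀ v, B (T t (ι v)) ∈ imageBall ι (C * t ^ (-β) * ‖v‖))
    (hs : s ∈ Ioc 0 τ) (x : X) :
    B (T s x) ∈ imageBall ι (C * s ^ (-β) * (C * 2 ^ (α + β) * s ^ (-α) * ‖x‖)) := by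
  have hs_half : 0 < s / 2 := half_pos hs.1
  have hs_mem : s / 2 ∈ Ioc 0 τ := ⟨hs_half, (half_le_self hs.1.le).trans hs.2⟩
  have hconst : 0 ≤ C * (s / 2) ^ (-β) := mul_nonneg hC (Real.rpow_nonneg hs_half.le _)
  rw [← add_halves s, hT.add_apply hs_half.le hs_half.le, add_halves]
  refine imageBall_mono (le_of_eq ?_) (map_mem_imageBall (L := fun y => B (T (s / 2) y))
    (hBV (s / 2) hs_mem) hconst (hTX (s / 2) hs_mem x))
  rw [Real.div_rpow hs.1.le two_pos.le, Real.div_rpow hs.1.le two_pos.le, Real.rpow_neg two_pos.le,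
    Real.rpow_neg two_pos.le, div_inv_eq_mul, div_inv_eq_mul, Real.rpow_add two_pos]
  ring

theorem exists_boundedInto_rpow [CompleteSpace X] (hT : IsC0Semigroup T)
    (hι : Function.Injective ι) (hα : 0 ≤ α) (hτ : 0 < τ)
    (hTX : ∀ t ∈ Ioc 0 τ, ∀ x, T t x ∈ imageBall ι (C * t ^ (-α) * ‖x‖)) (r : ℝ) :
    ∃ C', 0 < C' ∧ ∀ t ∈ Ioc 0 r, BoundedInto ι (T t) (C' * t ^ (-α)) := by
  obtain ⟨M, hM, hT_bound⟩ := exists_norm_le_of_continuousOn_orbit isCompact_Icc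
    (hT.isLocalC0Semigroup r).continuousOn_orbit
  refine ⟨1 + |C| * max 1 (τ ^ (-α) * M * r ^ α), by positivity, fun t ht => ?_⟩
  have htα : 0 ≤ t ^ (-α) := Real.rpow_nonneg ht.1.le _
  refine boundedInto_of_forall_mem_imageBall hι (by positivity) fun x => ?_
  have hmono : ∀ {b}, b ≤ max 1 (τ ^ (-α) * M * r ^ α) →
      |C| * b * t ^ (-α) * ‖x‖ ≤ (1 + |C| * max 1 (τ ^ (-α) * M * r ^ α)) * t ^ (-α) * ‖x‖ := by
    intro b hb
    gcongr
    exact (mul_le_mul_of_nonneg_left hb (abs_nonneg C)).trans (le_add_of_nonneg_left zero_le_one)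
  rcases le_or_gt t τ with htτ | hτt
  · refine imageBall_mono (le_trans ?_ (hmono (le_max_left _ _))) (hTX t ⟨ht.1, htτ⟩ x)
    rw [mul_one]
    gcongr
    exact le_abs_self C
  · rw [← add_sub_cancel τ t, hT.add_apply hτ.le (sub_nonneg.2 hτt.le), add_sub_cancel]
    refine imageBall_mono (le_trans ?_ (hmono (le_max_right _ _)))
      (hTX τ ⟨hτ, le_rfl⟩ (T (t - τ) x))
    have hrt : 1 ≤ r ^ α * t ^ (-α) := by
      rw [Real.rpow_neg ht.1.le, ← div_eq_mul_inv, one_le_div₀ (Real.rpow_pos_of_pos ht.1 α)]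
      exact Real.rpow_le_rpow ht.1.le ht.2 hα
    calc C * τ ^ (-α) * ‖T (t - τ) x‖ ≤ |C| * τ ^ (-α) * (M * ‖x‖) := by
          gcongr
          · exact le_abs_self C
          · exact (T (t - τ)).le_of_opNorm_le
              (hT_bound _ ⟨sub_nonneg.2 hτt.le, (sub_le_self t hτ.le).trans ht.2⟩) x
      _ ≤ |C| * τ ^ (-α) * (M * ‖x‖) * (r ^ α * t ^ (-α)) :=
          le_mul_of_one_le_right (by positivity) hrt
      _ = |C| * (τ ^ (-α) * M * r ^ α) * t ^ (-α) * ‖x‖ := by ring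

end IsC0Semigroup

theorem IsStronglyIntegrableOn.exists_perturbation_mem_imageBall [CompleteSpace X]
    [CompleteSpace V] [NormedSpace ℝ X] [IsScalarTower ℝ 𝕜 X]
    (hBT : IsStronglyIntegrableOn (fun s => B ∘ₗ (T s : X →ₗ[𝕜] X)) τ q) (hq : q < 1)
    (hT : IsC0Semigroup T) (hι : Function.Injective ι)
    (hV : TopologicalSpace.SeparableSpace V ∨ IsClosed (imageBall ι 1))
    (hκ : IsIntegrableMajorantOn (fun s => C * s ^ (-β)) τ ρ) (hρ : ρ < 1) (hα : 0 ≤ α)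
    (hC : 1 ≤ C) (hTX : ∀ t ∈ Ioc 0 τ, ∀ x, T t x ∈ imageBall ι (C * t ^ (-α) * ‖x‖))
    (hTV : ∀ t ∈ Ioc 0 τ, ∀ v, T t (ι v) ∈ imageBall ι (C * ‖v‖))
    (hBV : ∀ t ∈ Ioc 0 τ, ∀ v, B (T t (ι v)) ∈ imageBall ι (C * t ^ (-β) * ‖v‖)) (hτ : 0 ≤ τ) :
    ∃ C', ∀ t ∈ Ioc 0 τ, ∀ x, hBT.perturbation hT hτ t x ∈ imageBall ι (C' * t ^ (-α) * ‖x‖) := by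
  have hC_nonneg : 0 ≤ C := zero_le_one.trans hC
  refine hBT.exists_dysonPhillips_mem_imageBall hq hι hV hκ hρ hα (D := C * 2 ^ (α + β)) (C := C)
    (by positivity) hBV (fun s hs x => hT.apply_orbit_mem_imageBall hC_nonneg hTX hBV hs x)
    hC_nonneg (fun t ht v => ?_) (fun t ht x => ?_)
  · rw [orbitMap_apply T hτ _ _ ht]
    rcases ht.1.eq_or_lt with rfl | ht_pos
    · rw [hT.zero_apply]
      exact mem_imageBall.2 ⟨v, rfl, le_mul_of_one_le_left (norm_nonneg v) hC⟩
    · exact hTV t ⟨ht_pos, ht.2⟩ v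
  · rw [orbitMap_apply T hτ _ _ (Ioc_subset_Icc_self ht)]
    exact hTX t ht x

end Embedding

section Generation

variable {𝕜 X : Type*} [RCLike 𝕜] [NormedAddCommGroup X] [NormedSpace 𝕜 X]
  {A B : X →ₗ.[𝕜] X} {B' : X →ₗ[𝕜] X} {S T : ℝ → X →L[𝕜] X} {x y : X} {τ q s : ℝ}

theorem extension_apply (hB' : B' ∘ₗ B.domain.subtype = B.toFun) (hx : x ∈ B.domain) :
    B' x = B ⟨x, hx⟩ :=
  LinearMap.congr_fun hB' ⟨x, hx⟩

theorem total_eq_extension (hB' : B' ∘ₗ B.domain.subtype = B.toFun) (hx : x ∈ B.domain) :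
    total B x = B' x := by
  rw [total, dif_pos hx, extension_apply hB' hx]

theorem mem_graph_add_iff (hAB : A.domain ≤ B.domain)
    (hB' : B' ∘ₗ B.domain.subtype = B.toFun) :
    (x, y) ∈ (A + B).graph ↔ (x, y - B' x) ∈ A.graph := by
  simp only [LinearPMap.mem_graph_iff]
  constructor
  · rintro ⟨u, rfl, rfl⟩
    refine ⟨⟨u, u.2.1⟩, rfl, eq_sub_of_add_eq ?_⟩
    rw [extension_apply hB' u.2.2]
    rfl
  · rintro ⟨u, rfl, hu⟩
    refine ⟨⟨u, u.2, hAB u.2⟩, rfl, ?_⟩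
    rw [← sub_add_cancel y (B' u), ← hu, extension_apply hB' (hAB u.2)]
    rfl

namespace IsGenerator

theorem mem_domain (hA : IsGenerator T A) (h : (x, y) ∈ generatorGraph T) : x ∈ A.domain :=
  LinearPMap.mem_domain_of_mem_graph ((isGenerator_iff_graph_eq.1 hA).symm ▸ h)

theorem isRelativelyBounded (hA : IsGenerator T A) (hAB : A.domain ≤ B.domain)
    (hB : ∃ K : ℝ, ∀ x : A.domain, ‖B ⟨x, hAB x.2⟩‖ ≤ K * (‖(x : X)‖ + ‖A x‖))
    (hB' : B' ∘ₗ B.domain.subtype = B.toFun) : IsRelativelyBounded T B' := by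
  obtain ⟨K, hK⟩ := hB
  refine ⟨|K| * 2, fun p hp => ?_⟩
  rw [← isGenerator_iff_graph_eq.1 hA] at hp
  obtain ⟨u, hu, hAu⟩ := LinearPMap.mem_graph_iff _ |>.1 hp
  calc ‖B' p.1‖ = ‖B ⟨u, hAB u.2⟩‖ := by rw [← hu, extension_apply hB' (hAB u.2)]
    _ ≤ |K| * (‖p.1‖ + ‖p.2‖) := by
        rw [← hu, ← hAu]
        exact (hK u).trans (by gcongr; exact le_abs_self K)
    _ ≤ |K| * (‖p‖ + ‖p‖) := by gcongr; exacts [norm_fst_le p, norm_snd_le p]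
    _ = |K| * 2 * ‖p‖ := by ring

theorem orbit_mem_domain (hA : IsGenerator T A) (hT : IsC0Semigroup T)
    (hdiff : ImmediatelyDifferentiable T) (hs : 0 < s) (x : X) : T s x ∈ A.domain :=
  (hdiff.exists_mem_generatorGraph hT hs x).elim fun _ h => hA.mem_domain h

theorem isStronglyIntegrableOn [NormedSpace ℝ X] [IsScalarTower ℝ 𝕜 X]
    (hA : IsGenerator T A) (hT : IsC0Semigroup T) (hdiff : ImmediatelyDifferentiable T)
    (hAB : A.domain ≤ B.domain)
    (hB' : B' ∘ₗ B.domain.subtype = B.toFun) (hrel : IsRelativelyBounded T B') (hτ : 0 < τ)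
    (hq : 0 ≤ q) (hBA : ∀ x ∈ A.domain, ∫ s in 0..τ, ‖total B (T s x)‖ ≤ q * ‖x‖) :
    IsStronglyIntegrableOn (fun s => B' ∘ₗ (T s : X →ₗ[𝕜] X)) τ q := by
  refine hrel.isStronglyIntegrableOn hT (fun s hs => hdiff.exists_mem_generatorGraph hT hs) hτ hq
    fun x y h => ?_
  have htotal : ∀ s ∈ Ioc 0 τ, ‖B' (T s x)‖ = ‖total B (T s x)‖ := fun s hs => by
    rw [total_eq_extension hB' (hAB (hA.orbit_mem_domain hT hdiff hs.1 x))]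
  rw [intervalIntegral.integral_of_le hτ.le, setIntegral_congr_fun measurableSet_Ioc htotal,
    ← intervalIntegral.integral_of_le hτ.le]
  exact hBA x (hA.mem_domain h)

theorem add_iff (hA : IsGenerator T A) (hAB : A.domain ≤ B.domain)
    (hB' : B' ∘ₗ B.domain.subtype = B.toFun) : IsGenerator S (A + B) ↔
      ∀ x y, (x, y) ∈ generatorGraph S ↔ (x, y - B' x) ∈ generatorGraph T := by
  rw [isGenerator_iff_graph_eq, SetLike.ext_iff, Prod.forall]
  simp only [mem_graph_add_iff hAB hB', isGenerator_iff_graph_eq.1 hA]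
  exact forall₂_congr fun x y => Iff.comm

end IsGenerator

theorem IsC0Semigroup.eq_of_isGenerator [CompleteSpace X] [NormedSpace ℝ X] [IsScalarTower ℝ 𝕜 X]
    (hT : IsC0Semigroup T) (hS : IsC0Semigroup S) (hTA : IsGenerator T A) (hSA : IsGenerator S A)
    {t : ℝ} (ht : 0 ≤ t) : S t = T t :=
  hT.eq_of_generatorGraph_le hS
    ((isGenerator_iff_graph_eq.1 hTA).symm.trans (isGenerator_iff_graph_eq.1 hSA)).le ht

end Generation

end UltraPerturb

end

theorem mainTheorem2 {𝕜 X V : Type*} [RCLike 𝕜]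
    [NormedAddCommGroup X] [NormedSpace 𝕜 X] [CompleteSpace X]
    [NormedAddCommGroup V] [NormedSpace 𝕜 V] [CompleteSpace V]
    -- the `C₀`-semigroup `T` on `X` and its generator `A`
    (T : ℝ → X →L[𝕜] X) (hT : UltraPerturb.IsC0Semigroup T)
    (A : X →ₗ.[𝕜] X) (hA : UltraPerturb.IsGenerator T A)
    -- the continuous embedding of `V` into `X`
    (ι : V →L[𝕜] X) (hι : Function.Injective ι)
    -- the operator `B`, with `dom A ⊆ dom B`, bounded on `dom A` for the graph norm
    (B : X →ₗ.[𝕜] X) (hAB : A.domain ≤ B.domain)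
    (hB : ∃ K : ℝ, ∀ x : A.domain,
      ‖B ⟨x, hAB x.2⟩‖ ≤ K * (‖(x : X)‖ + ‖A x‖))
    (C α β q t₀ : ℝ) (hC : 1 ≤ C) (hα : 0 < α) (hβ : β ∈ Set.Ico (0 : ℝ) 1)
    (hq : q ∈ Set.Ioo (0 : ℝ) 1) (ht₀ : 0 < t₀)
    -- (S1)
    (hS1 : ∀ t ∈ Set.Ioc (0 : ℝ) 1, UltraPerturb.BoundedInto ι (T t) (C * t ^ (-α)))
    -- (S2)
    (hS2 : ∀ x ∈ A.domain, (∫ s in (0 : ℝ)..t₀, ‖UltraPerturb.total B (T s x)‖) ≤ q * ‖x‖)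
    -- (S3)
    (hS3 : ∀ t ∈ Set.Ioc (0 : ℝ) 1, UltraPerturb.BoundedInto ι (T t ∘L ι) C)
    (hS3' : ∀ t ∈ Set.Ioc (0 : ℝ) 1, ∀ x : V, ∀ h : T t (ι x) ∈ B.domain,
      ∃ v : V, ι v = B ⟨T t (ι x), h⟩ ∧ ‖v‖ ≤ C * t ^ (-β) * ‖x‖)
    -- `V` is separable, or its closed unit ball is closed in `X`
    (hV : TopologicalSpace.SeparableSpace V ∨ IsClosed (ι '' Metric.closedBall (0 : V) 1))
    (hdiff : UltraPerturb.ImmediatelyDifferentiable T) :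
    (∃ S : ℝ → X →L[𝕜] X,
      UltraPerturb.IsC0Semigroup S ∧ UltraPerturb.IsGenerator S (A + B)) ∧
    ∀ S : ℝ → X →L[𝕜] X,
      UltraPerturb.IsC0Semigroup S → UltraPerturb.IsGenerator S (A + B) →
        ∃ C' : ℝ, 0 < C' ∧
          ∀ t ∈ Set.Ioc (0 : ℝ) 1, UltraPerturb.BoundedInto ι (S t) (C' * t ^ (-α)) := by
  let : NormedSpace ℝ X := NormedSpace.restrictScalars ℝ 𝕜 X
  have : IsScalarTower ℝ 𝕜 X := IsScalarTower.of_algebraMap_smul fun _ _ => rfl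
  obtain ⟨B', hB'⟩ := B.toFun.exists_extend
  have hdom : ∀ t ∈ Ioc 0 1, ∀ x, T t x ∈ B.domain := fun t ht x =>
    hAB (hA.orbit_mem_domain hT hdiff ht.1 x)
  have hB'V : ∀ t ∈ Ioc 0 1, ∀ v, B' (T t (ι v)) ∈ UltraPerturb.imageBall ι (C * t ^ (-β) * ‖v‖) :=
    fun t ht v => UltraPerturb.mem_imageBall.2 <|
      UltraPerturb.extension_apply hB' (hdom t ht _) ▸ hS3' t ht v (hdom t ht _)
  have hrel := hA.isRelativelyBounded hAB hB hB'
  have hB'T₀ := hA.isStronglyIntegrableOn hT hdiff hAB hB' hrel ht₀ hq.1.le hS2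
  obtain ⟨τ, ⟨hτ, hτ_le⟩, hκ⟩ := UltraPerturb.exists_isIntegrableMajorantOn_rpow
    (zero_le_one.trans hC) hβ.2 one_half_pos (lt_min ht₀ one_pos)
  have hIoc : Ioc 0 τ ⊆ Ioc 0 1 := Ioc_subset_Ioc_right (hτ_le.trans (min_le_right _ _))
  have hB'T := hB'T₀.mono (hτ_le.trans (min_le_left _ _))
  obtain ⟨S₀, hS₀, hS₀U, hS₀G⟩ := hrel.exists_perturbed_semigroup hT hB'T hq.2 hτ
  have hS₀A : UltraPerturb.IsGenerator S₀ (A + B) := (hA.add_iff hAB hB').2 hS₀G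
  obtain ⟨D, hD⟩ := hB'T.exists_perturbation_mem_imageBall hq.2 hT hι hV hκ one_half_lt_one hα.le
    hC (fun t ht => (hS1 t (hIoc ht)).mem_imageBall) (fun t ht => (hS3 t (hIoc ht)).mem_imageBall)
    (fun t ht => hB'V t (hIoc ht)) hτ.le
  obtain ⟨C', hC', hS₀V⟩ := hS₀.exists_boundedInto_rpow hι hα.le hτ
    (fun t ht => hS₀U (Ioc_subset_Icc_self ht) ▸ hD t ht) 1
  refine ⟨⟨S₀, hS₀, hS₀A⟩, fun S hS hSA => ⟨C', hC', fun t ht => ?_⟩⟩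
  exact hS₀.eq_of_isGenerator hS hS₀A hSA ht.1.le ▸ hS₀V t ht
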